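/- Let $L$ be a Lie conformal algebra over $\mathbb{C}$, i.e. a $\mathbb{C}[\partial]$-module with a conformally sesquilinear $\lambda$-bracket $[\cdot_\lambda\cdot]:L\times L\to L[\lambda]$ satisfying $[p_\lambda q]=-[q_{-\lambda-\partial}\,p]$ and the Jacobi identity, and let $N:L\to L$ be a Nijenhuis operator, i.e. a $\mathbb{C}[\partial]$-linear map with $$[N(p)_\lambda N(q)]=N\big([N(p)_\lambda q]+[p_\lambda N(q)]-N([p_\lambda q])\big)\qquad(p,q\in L).$$ Let $(L,[\cdot_\lambda\cdot]_N)$ be the induced Lie conformal algebra, with $[p_\lambda q]_N=[N(p)_\lambda q]+[p_\lambda N(q)]-N([p_\lambda q])$. For $n\ge 0$ let $C^n(L,L)$ be the space of $n$-cochains: $\mathbb{C}$-multilinear maps $f_{\lambda_1,\dots,\lambda_{n-1}}:L^{n}\to L[\lambda_1,\dots,\lambda_{n-1}]$ that are conformally sesquilinear, $f(\dots,\partial p_k,\dots)=-\lambda_k f(\dots,p_k,\dots)$ for $1\le k\le n$, and conformally skew-symmetric under simultaneous permutations of the $p_k$ and the $\lambda_k$, where $\lambda_n=-\partial-\lambda_1-\dots-\lambda_{n-1}$;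 $C^0(L,L)=L/\partial L$. Let $\delta$ be the coboundary operator of $(L,[\cdot_\lambda\cdot])$ with adjoint coefficients, $$(\delta f)_{\lambda_1,\dots,\lambda_n}(p_1,\dots,p_{n+1})=\sum_{i=1}^{n+1}(-1)^{i+1}[{p_i}_{\lambda_i}f_{\dots\hat{\lambda_i}\dots}(\dots,\hat{p_i},\dots)]+\sum_{i<j}(-1)^{i+j}f_{\lambda_i+\lambda_j,\dots\hat{\lambda_i}\dots\hat{\lambda_j}\dots}([{p_i}_{\lambda_i}p_j],\dots,\hat{p_i},\dots,\hat{p_j},\dots)$$ (with $\lambda_{n+1}=-\partial-\lambda_1-\dots-\lambda_n$), let $\delta_N$ be the coboundary operator of $(L,[\cdot_\lambda\cdot]_N)$ with coefficients in its adjoint representation, given by the same formula with $[\cdot_\lambda\cdot]_N$, and let $d_N:C^n(L,L)\to C^{n+1}(L,L)$ be the differential of the Nijenhuis operator, $$d_Nf=\sum_{i=1}^{n+1}(-1)^{i+1}[N(p_i)_{\lambda_i}f_{\dots\hat{\lambda_i}\dots}(\dots,\hat{p_i},\dots)]+\sum_{i<j}(-1)^{i+j}f_{\lambda_i+\lambda_j,\dots}([{p_i}_{\lambda_i}p_j]_N,\dots,\hat{p_i},\dots,\hat{p_j},\dots)-N(\delta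 f),$$ whose cohomology is denoted $H^*_N(L)$. For $n\ge0$ put $\Phi^n:C^n(L,L)\to C^{n+1}(L,L)$, $\Phi^n(f)=(-1)^{n+1}\delta f$. Then $\delta_N\circ\Phi^n=\Phi^{n+1}\circ d_N$ for all $n\ge 0$. Consequently, for every $n\ge0$ there is a linear map $$H^n_N(L)\to H^{n+1}\big((L,[\cdot_\lambda\cdot]_N),(L,[\cdot_\lambda\cdot]_N)\big),\qquad [f]\mapsto[\Phi^n(f)],$$ from the cohomology of the Nijenhuis operator to the cohomology of the induced Lie conformal algebra with coefficients in its adjoint representation. -/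

import Mathlib

open scoped TensorProduct Polynomial

namespace LieConformal

section Coefficients
variable {L : Type*} [AddCommGroup L] [Module ℂ L]
variable {R S T : Type*} [CommRing R] [Algebra ℂ R] [CommRing S] [Algebra ℂ S]
  [CommRing T] [Algebra ℂ T]

/-- Change of coefficients `R[L] → S[L]` along `φ : R → S`. Throughout, `L` with polynomial
coefficients in a ring `R` of polynomials in the formal variables `λ` is `R ⊗[ℂ] L`; in particular
`L[λ]` is `ℂ[X] ⊗[ℂ] L`, where the variable `X` is `λ`. For `a : R`, `mapCoeff (Polynomial.aeval a)`
is the substitution `λ ↦ a`. -/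
noncomputable def mapCoeff (φ : R →ₐ[ℂ] S) : R ⊗[ℂ] L →ₗ[ℂ] S ⊗[ℂ] L :=
  LinearMap.rTensor L φ.toLinearMap

@[simp] theorem mapCoeff_tmul (φ : R →ₐ[ℂ] S) (r : R) (p : L) :
    mapCoeff φ (r ⊗ₜ p) = φ r ⊗ₜ[ℂ] p := rfl

theorem mapCoeff_smul (φ : R →ₐ[ℂ] S) (r : R) (u : R ⊗[ℂ] L) :
    mapCoeff φ (r • u) = φ r • mapCoeff φ u := by
  induction u with
  | zero => simp
  | add x y hx hy => simp [smul_add, hx, hy]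
  | tmul s p => simp [TensorProduct.smul_tmul']

theorem mapCoeff_mapCoeff (φ : R →ₐ[ℂ] S) (ψ : S →ₐ[ℂ] T) (u : R ⊗[ℂ] L) :
    mapCoeff ψ (mapCoeff φ u) = mapCoeff (ψ.comp φ) u := by
  induction u with
  | zero => simp
  | add x y hx hy => simp [hx, hy]
  | tmul s p => simp

theorem mapCoeff_baseChange (φ : R →ₐ[ℂ] S) (f : L →ₗ[ℂ] L) (u : R ⊗[ℂ] L) :
    mapCoeff φ (f.baseChange R u) = f.baseChange S (mapCoeff φ u) := by
  induction u with
  | zero => simp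
  | add x y hx hy => simp [hx, hy]
  | tmul s p => simp

/-- For a `λ`-bracket `β : L × L → L[λ]` and `a : R`, the operation `(u, v) ↦ [u_a v]` on `R ⊗ L`:
the `R`-bilinear extension of `(p, q) ↦ β(p, q)` with `a` substituted for `λ`. -/
noncomputable def extend (β : L →ₗ[ℂ] L →ₗ[ℂ] ℂ[X] ⊗[ℂ] L) (a : R) :
    R ⊗[ℂ] L →ₗ[R] R ⊗[ℂ] L →ₗ[R] R ⊗[ℂ] L :=
  LinearMap.liftBaseChange R
    { toFun := fun p => LinearMap.liftBaseChange R (mapCoeff (Polynomial.aeval a) ∘ₗ β p)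
      map_add' := fun p q => by ext; simp
      map_smul' := fun c p => by ext; simp }

@[simp] theorem extend_tmul (β : L →ₗ[ℂ] L →ₗ[ℂ] ℂ[X] ⊗[ℂ] L) (a r s : R) (p q : L) :
    extend β a (r ⊗ₜ p) (s ⊗ₜ q) = (r * s) • mapCoeff (Polynomial.aeval a) (β p q) := by
  simp [extend, mul_smul]

theorem mapCoeff_extend (β : L →ₗ[ℂ] L →ₗ[ℂ] ℂ[X] ⊗[ℂ] L) (φ : R →ₐ[ℂ] S) (a : R)
    (u v : R ⊗[ℂ] L) :
    mapCoeff φ (extend β a u v) = extend β (φ a) (mapCoeff φ u) (mapCoeff φ v) := by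
  induction u with
  | zero => simp
  | add x y hx hy => simp [hx, hy]
  | tmul r p =>
    induction v with
    | zero => simp
    | add x y hx hy => simp [hx, hy]
    | tmul s q =>
      have h : φ.comp (Polynomial.aeval a) = Polynomial.aeval (φ a) := by ext; simp
      simp [mapCoeff_smul, mapCoeff_mapCoeff, h]

end Coefficients

section Algebras
variable (L : Type*) [AddCommGroup L] [Module ℂ L] [Module ℂ[X] L] [IsScalarTower ℂ ℂ[X] L]

/-- The operator `∂` of a `ℂ[∂]`-module `L`. The action of `ℂ[∂]` is the given `ℂ[X]`-module
structure of `L`. -/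
noncomputable def del : L →ₗ[ℂ] L := Algebra.lsmul ℂ ℂ L (Polynomial.X : ℂ[X])

/-- A `λ`-bracket `L × L → L[λ]`, `ℂ`-bilinear and conformally sesquilinear:
`[∂p_λ q] = -λ[p_λ q]` and `[p_λ ∂q] = (∂ + λ)[p_λ q]`. -/
structure SesquilinearBracket where
  bracket : L →ₗ[ℂ] L →ₗ[ℂ] ℂ[X] ⊗[ℂ] L
  del_left : ∀ p q, bracket (del L p) q = -((Polynomial.X : ℂ[X]) • bracket p q)
  del_right : ∀ p q, bracket p (del L q) =
    (del L).baseChange ℂ[X] (bracket p q) + (Polynomial.X : ℂ[X]) • bracket p q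

/-- The substitution `λ ↦ -λ-∂` on `L[λ]`: it sends `∑ λ^k c_k` to `∑ (-λ-∂)^k c_k`. -/
noncomputable def dagger : ℂ[X] ⊗[ℂ] L →ₗ[ℂ] ℂ[X] ⊗[ℂ] L :=
  TensorProduct.lift (LinearMap.mk₂ ℂ
    (fun P c => Polynomial.aeval
      (-(Polynomial.X : ℂ[X]) • (LinearMap.id : ℂ[X] ⊗[ℂ] L →ₗ[ℂ] ℂ[X] ⊗[ℂ] L)
        - ((del L).baseChange ℂ[X]).restrictScalars ℂ) P ((1 : ℂ[X]) ⊗ₜ[ℂ] c))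
    (by simp) (by simp) (by simp [TensorProduct.tmul_add]) (by simp))

/-- A Lie conformal algebra structure on the `ℂ[∂]`-module `L`: a sesquilinear `λ`-bracket with
`[p_λ q] = -[q_{-λ-∂} p]` and `[p_λ [q_μ r]] = [[p_λ q]_{λ+μ} r] + [q_μ [p_λ r]]` in `L[λ, μ]`;
here `λ` and `μ` are `MvPolynomial.X 0` and `MvPolynomial.X 1`. -/
structure LieConformalAlgebra extends SesquilinearBracket L where
  skew : ∀ p q, bracket p q = -dagger L (bracket q p)
  jacobi : ∀ p q r,
    extend bracket (MvPolynomial.X 0 : MvPolynomial (Fin 2) ℂ) (1 ⊗ₜ p)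
        (extend bracket (MvPolynomial.X 1) (1 ⊗ₜ q) (1 ⊗ₜ r)) =
      extend bracket (MvPolynomial.X 0 + MvPolynomial.X 1)
        (extend bracket (MvPolynomial.X 0) (1 ⊗ₜ p) (1 ⊗ₜ q)) (1 ⊗ₜ r) +
      extend bracket (MvPolynomial.X 1 : MvPolynomial (Fin 2) ℂ) (1 ⊗ₜ q)
        (extend bracket (MvPolynomial.X 0) (1 ⊗ₜ p) (1 ⊗ₜ r))

section Nijenhuis
variable {L}
variable {R : Type*} [CommRing R] [Algebra ℂ R]

theorem SesquilinearBracket.extend_del_left (B : SesquilinearBracket L) (a : R)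
    (u v : R ⊗[ℂ] L) :
    extend B.bracket a ((del L).baseChange R u) v = -(a • extend B.bracket a u v) := by
  induction u with
  | zero => simp
  | add x y hx hy => simp [hx, hy, smul_add]; abel
  | tmul r p =>
    induction v with
    | zero => simp
    | add x y hx hy => simp only [map_add, hx, hy, smul_add]; abel
    | tmul s q => simp [B.del_left, mapCoeff_smul, smul_smul, mul_comm]

theorem SesquilinearBracket.extend_del_right (B : SesquilinearBracket L) (a : R)
    (u v : R ⊗[ℂ] L) :
    extend B.bracket a u ((del L).baseChange R v) =
      (del L).baseChange R (extend B.bracket a u v) + a • extend B.bracket a u v := by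
  induction u with
  | zero => simp
  | add x y hx hy => simp [hx, hy, smul_add]; abel
  | tmul r p =>
    induction v with
    | zero => simp
    | add x y hx hy => simp only [map_add, hx, hy, smul_add]; abel
    | tmul s q =>
      simp [B.del_right, mapCoeff_smul, mapCoeff_baseChange, smul_smul, mul_comm]

variable (N : L →ₗ[ℂ[X]] L)

theorem del_comm (p : L) : N (del L p) = del L (N p) := by simp [del]

theorem baseChange_del_comm (u : R ⊗[ℂ] L) :
    (N.restrictScalars ℂ).baseChange R ((del L).baseChange R u) =
      (del L).baseChange R ((N.restrictScalars ℂ).baseChange R u) := by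
  induction u with
  | zero => simp
  | add x y hx hy => simp [hx, hy]
  | tmul s p => simp [del_comm]

/-- The bracket `(p, q) ↦ [N(p)_λ q]`. -/
noncomputable def SesquilinearBracket.compLeft (B : SesquilinearBracket L) :
    SesquilinearBracket L where
  bracket := B.bracket ∘ₗ N.restrictScalars ℂ
  del_left p q := by simp [del_comm, B.del_left]
  del_right p q := by simp [B.del_right]

/-- The deformed bracket `[p_λ q]_N = [N(p)_λ q] + [p_λ N(q)] - N([p_λ q])`. -/
noncomputable def SesquilinearBracket.deform (B : SesquilinearBracket L) :
    SesquilinearBracket L where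
  bracket := LinearMap.mk₂ ℂ
    (fun p q => B.bracket (N p) q + B.bracket p (N q)
      - (N.restrictScalars ℂ).baseChange ℂ[X] (B.bracket p q))
    (by intros; simp only [map_add, LinearMap.add_apply]; abel)
    (by intro c p q; rw [← LinearMap.restrictScalars_apply ℂ N, map_smul]; simp [smul_add, smul_sub])
    (by intros; simp only [map_add]; abel)
    (by intro c p q; rw [← LinearMap.restrictScalars_apply ℂ N q,
          ← LinearMap.restrictScalars_apply ℂ N (c • q), map_smul]; simp [smul_add, smul_sub])
  del_left p q := by
    simp only [LinearMap.mk₂_apply, del_comm, B.del_left, map_neg, map_smul, smul_sub, smul_add]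
    abel
  del_right p q := by
    simp only [LinearMap.mk₂_apply, del_comm, B.del_right, map_add, map_sub, map_smul, smul_sub,
      smul_add, baseChange_del_comm]
    abel

theorem SesquilinearBracket.extend_deform (B : SesquilinearBracket L) (a : R)
    (u v : R ⊗[ℂ] L) :
    extend (B.deform N).bracket a u v =
      extend B.bracket a ((N.restrictScalars ℂ).baseChange R u) v
      + extend B.bracket a u ((N.restrictScalars ℂ).baseChange R v)
      - (N.restrictScalars ℂ).baseChange R (extend B.bracket a u v) := by
  induction u with
  | zero => simp
  | add x y hx hy => simp only [map_add, LinearMap.add_apply, hx, hy]; abel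
  | tmul r p =>
    induction v with
    | zero => simp
    | add x y hx hy => simp only [map_add, hx, hy]; abel
    | tmul s q =>
      simp [SesquilinearBracket.deform, mapCoeff_baseChange, smul_add, smul_sub]

/-- The `ℂ[∂]`-linear map `N` is a Nijenhuis operator:
`[N(p)_λ N(q)] = N([N(p)_λ q] + [p_λ N(q)] - N([p_λ q]))`. -/
def LieConformalAlgebra.IsNijenhuis (A : LieConformalAlgebra L) (N : L →ₗ[ℂ[X]] L) : Prop :=
  ∀ p q, A.bracket (N p) (N q) =
    (N.restrictScalars ℂ).baseChange ℂ[X]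
      (A.bracket (N p) q + A.bracket p (N q)
        - (N.restrictScalars ℂ).baseChange ℂ[X] (A.bracket p q))

theorem LieConformalAlgebra.IsNijenhuis.extend {A : LieConformalAlgebra L} {N : L →ₗ[ℂ[X]] L}
    (hN : A.IsNijenhuis N) (a : R) (u v : R ⊗[ℂ] L) :
    extend A.bracket a ((N.restrictScalars ℂ).baseChange R u)
        ((N.restrictScalars ℂ).baseChange R v) =
      (N.restrictScalars ℂ).baseChange R (extend (A.deform N).bracket a u v) := by
  induction u with
  | zero => simp
  | add x y hx hy => simp [hx, hy]
  | tmul r p =>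
    induction v with
    | zero => simp
    | add x y hx hy => simp only [map_add, hx, hy]
    | tmul s q =>
      have := hN p q
      simp [SesquilinearBracket.deform, this, mapCoeff_baseChange]

theorem LieConformalAlgebra.jacobi_extend (A : LieConformalAlgebra L)
    (u v w : MvPolynomial (Fin 2) ℂ ⊗[ℂ] L) :
    extend A.bracket (MvPolynomial.X 0) u (extend A.bracket (MvPolynomial.X 1) v w) =
      extend A.bracket (MvPolynomial.X 0 + MvPolynomial.X 1)
        (extend A.bracket (MvPolynomial.X 0) u v) w +
      extend A.bracket (MvPolynomial.X 1) v (extend A.bracket (MvPolynomial.X 0) u w) := by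
  have one (r : MvPolynomial (Fin 2) ℂ) (p : L) : r ⊗ₜ[ℂ] p = r • (1 ⊗ₜ[ℂ] p) := by
    simp [TensorProduct.smul_tmul']
  induction u with
  | zero => simp
  | add x y hx hy => simp only [map_add, LinearMap.add_apply, hx, hy]; abel
  | tmul r p =>
    induction v with
    | zero => simp
    | add x y hx hy => simp only [map_add, LinearMap.add_apply, hx, hy]; abel
    | tmul s q =>
      induction w with
      | zero => simp
      | add x y hx hy => simp only [map_add, hx, hy]; abel
      | tmul t w =>
        rw [one r, one s, one t]
        simp only [map_smul, LinearMap.smul_apply, A.jacobi, smul_add, smul_smul]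
        congr 2 <;> ring

theorem dagger_baseChange (z : ℂ[X] ⊗[ℂ] L) :
    dagger L ((N.restrictScalars ℂ).baseChange ℂ[X] z) =
      (N.restrictScalars ℂ).baseChange ℂ[X] (dagger L z) := by
  induction z with
  | zero => simp
  | add x y hx hy => simp [hx, hy]
  | tmul P c =>
    simp only [dagger, LinearMap.baseChange_tmul, TensorProduct.lift.tmul, LinearMap.mk₂_apply]
    induction P using Polynomial.induction_on' with
    | add P Q hP hQ => simp only [map_add, LinearMap.add_apply, hP, hQ]
    | monomial n a =>
      simp only [Polynomial.aeval_monomial, Module.End.mul_apply, Module.algebraMap_end_apply,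
        LinearMap.map_smul_of_tower]
      congr 1
      induction n with
      | zero => simp
      | succ n ih =>
        simp only [pow_succ', Module.End.mul_apply, ih]
        simp [baseChange_del_comm]

theorem jacobi_of_nijenhuis {R M : Type*} [CommRing R] [AddCommGroup M] [Module R M]
    (B C D : M →ₗ[R] M →ₗ[R] M) (n : M →ₗ[R] M)
    (hB : ∀ u v, B (n u) (n v) = n (B (n u) v + B u (n v) - n (B u v)))
    (hC : ∀ u v, C (n u) (n v) = n (C (n u) v + C u (n v) - n (C u v)))
    (hD : ∀ u v, D (n u) (n v) = n (D (n u) v + D u (n v) - n (D u v)))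
    (J : ∀ u v w, B u (C v w) = D (B u v) w + C v (B u w)) (u v w : M) :
    B (n u) (C (n v) w + C v (n w) - n (C v w)) + B u (n (C (n v) w + C v (n w) - n (C v w)))
        - n (B u (C (n v) w + C v (n w) - n (C v w))) =
      (D (n (B (n u) v + B u (n v) - n (B u v))) w + D (B (n u) v + B u (n v) - n (B u v)) (n w)
        - n (D (B (n u) v + B u (n v) - n (B u v)) w)) +
      (C (n v) (B (n u) w + B u (n w) - n (B u w)) + C v (n (B (n u) w + B u (n w) - n (B u w)))
        - n (C v (B (n u) w + B u (n w) - n (B u w)))) := by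
  rw [← hC v w, ← hB u v, ← hB u w]
  simp only [map_add, map_sub, LinearMap.add_apply, LinearMap.sub_apply, hB u (C v w),
    hD (B u v) w, hC v (B u w), J]
  abel

theorem LieConformalAlgebra.IsNijenhuis.jacobi_deform {A : LieConformalAlgebra L}
    {N : L →ₗ[ℂ[X]] L} (hN : A.IsNijenhuis N) (a b : R)
    (J : ∀ u v w : R ⊗[ℂ] L, LieConformal.extend A.bracket a u (LieConformal.extend A.bracket b v w) =
      LieConformal.extend A.bracket (a + b) (LieConformal.extend A.bracket a u v) w +
      LieConformal.extend A.bracket b v (LieConformal.extend A.bracket a u w)) (u v w : R ⊗[ℂ] L) :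
    LieConformal.extend (A.deform N).bracket a u (LieConformal.extend (A.deform N).bracket b v w) =
      LieConformal.extend (A.deform N).bracket (a + b)
        (LieConformal.extend (A.deform N).bracket a u v) w +
      LieConformal.extend (A.deform N).bracket b v
        (LieConformal.extend (A.deform N).bracket a u w) := by
  have hn := fun c x y => (hN.extend (R := R) c x y).trans (congrArg _ (A.extend_deform N c x y))
  simp only [A.extend_deform]
  exact jacobi_of_nijenhuis _ _ _ _ (hn a) (hn b) (hn (a + b)) J u v w

/-- The induced Lie conformal algebra `(L, [·_λ ·]_N)` of a Nijenhuis operator `N`. -/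
noncomputable def LieConformalAlgebra.deformed (A : LieConformalAlgebra L) (N : L →ₗ[ℂ[X]] L)
    (hN : A.IsNijenhuis N) : LieConformalAlgebra L where
  toSesquilinearBracket := A.deform N
  skew p q := by
    simp only [SesquilinearBracket.deform, LinearMap.mk₂_apply, map_sub, map_add,
      dagger_baseChange]
    rw [A.skew p q, A.skew (N p) q, A.skew p (N q)]
    simp only [map_neg]
    abel
  jacobi p q r := by
    exact hN.jacobi_deform _ _ A.jacobi_extend _ _ _

end Nijenhuis

end Algebras

section Cochains
variable (L : Type*) [AddCommGroup L] [Module ℂ L] [Module ℂ[X] L] [IsScalarTower ℂ ℂ[X] L]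

/-- `L[λ_1, …, λ_n]`. -/
abbrev LPoly (n : ℕ) : Type _ := MvPolynomial (Fin n) ℂ ⊗[ℂ] L

/-- The operator `∂ + λ_1 + … + λ_n` on `L[λ_1, …, λ_n]`. -/
noncomputable def total (n : ℕ) : LPoly L n →ₗ[MvPolynomial (Fin n) ℂ] LPoly L n :=
  (del L).baseChange (MvPolynomial (Fin n) ℂ) +
    (∑ k, MvPolynomial.X k : MvPolynomial (Fin n) ℂ) • LinearMap.id

/-- The values of `n`-cochains: `L[λ_1, …, λ_n]` with the relation `λ_1 + … + λ_n = -∂` imposed.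
For `n ≥ 1` this is `L[λ_1, …, λ_{n-1}]`, the last variable being `λ_n = -∂ - λ_1 - … - λ_{n-1}`
(see `Values.ofReduced` and the two theorems after it, which show that it is a bijection); for
`n = 0` it is `L / ∂L`. -/
def Values (n : ℕ) : Type _ := LPoly L n ⧸ LinearMap.range (total L n)

noncomputable instance (n : ℕ) : AddCommGroup (Values L n) :=
  inferInstanceAs (AddCommGroup (LPoly L n ⧸ LinearMap.range (total L n)))

noncomputable instance (n : ℕ) : Module (MvPolynomial (Fin n) ℂ) (Values L n) :=
  inferInstanceAs (Module (MvPolynomial (Fin n) ℂ) (LPoly L n ⧸ LinearMap.range (total L n)))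

noncomputable instance (n : ℕ) : Module ℂ (Values L n) :=
  inferInstanceAs (Module ℂ (LPoly L n ⧸ LinearMap.range (total L n)))

instance (n : ℕ) : IsScalarTower ℂ (MvPolynomial (Fin n) ℂ) (Values L n) :=
  inferInstanceAs
    (IsScalarTower ℂ (MvPolynomial (Fin n) ℂ) (LPoly L n ⧸ LinearMap.range (total L n)))

variable {L}

theorem total_apply (n : ℕ) (u : LPoly L n) : total L n u =
    (del L).baseChange (MvPolynomial (Fin n) ℂ) u +
      (∑ k, MvPolynomial.X k : MvPolynomial (Fin n) ℂ) • u := rfl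

/-- The class of a polynomial. -/
noncomputable def Values.mk (n : ℕ) : LPoly L n →ₗ[MvPolynomial (Fin n) ℂ] Values L n :=
  (LinearMap.range (total L n)).mkQ

theorem Values.mk_surjective (n : ℕ) : Function.Surjective (Values.mk (L := L) n) :=
  Submodule.mkQ_surjective _

theorem Values.mk_total (n : ℕ) (u : LPoly L n) : Values.mk n (total L n u) = 0 :=
  (Submodule.Quotient.mk_eq_zero _).2 ⟨u, rfl⟩

/-- Maps out of `Values L n`. -/
noncomputable def Values.lift {n : ℕ} {W : Type*} [AddCommGroup W] [Module ℂ W]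
    (φ : LPoly L n →ₗ[ℂ] W) (h : ∀ u, φ (total L n u) = 0) : Values L n →ₗ[ℂ] W :=
  (((LinearMap.range (total L n)).restrictScalars ℂ).liftQ φ (by rintro _ ⟨u, rfl⟩; exact h u)) ∘ₗ
    (Submodule.Quotient.restrictScalarsEquiv ℂ (LinearMap.range (total L n))).symm.toLinearMap

theorem Values.lift_mk {n : ℕ} {W : Type*} [AddCommGroup W] [Module ℂ W]
    (φ : LPoly L n →ₗ[ℂ] W) (h : ∀ u, φ (total L n u) = 0) (u : LPoly L n) :
    Values.lift φ h (Values.mk n u) = φ u := rfl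

/-- The substitution of polynomials for the variables, when it preserves the sum of all variables. -/
noncomputable def Values.subst {m n : ℕ}
    (e : MvPolynomial (Fin m) ℂ →ₐ[ℂ] MvPolynomial (Fin n) ℂ)
    (he : e (∑ k, MvPolynomial.X k) = ∑ k, MvPolynomial.X k) : Values L m →ₗ[ℂ] Values L n :=
  Values.lift ((Values.mk n).restrictScalars ℂ ∘ₗ mapCoeff e) (fun u => by
    have : mapCoeff e (total L m u) = total L n (mapCoeff e u) := by
      simp only [total_apply, map_add, mapCoeff_baseChange, mapCoeff_smul, he]
    simp [this, Values.mk_total])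

theorem Values.subst_mk {m n : ℕ} (e : MvPolynomial (Fin m) ℂ →ₐ[ℂ] MvPolynomial (Fin n) ℂ)
    (he : e (∑ k, MvPolynomial.X k) = ∑ k, MvPolynomial.X k) (u : LPoly L m) :
    Values.subst e he (Values.mk m u) = Values.mk n (mapCoeff e u) := rfl

theorem Values.subst_smul {m n : ℕ} (e : MvPolynomial (Fin m) ℂ →ₐ[ℂ] MvPolynomial (Fin n) ℂ)
    (he : e (∑ k, MvPolynomial.X k) = ∑ k, MvPolynomial.X k) (P : MvPolynomial (Fin m) ℂ)
    (v : Values L m) : Values.subst e he (P • v) = e P • Values.subst e he v := by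
  obtain ⟨u, rfl⟩ := Values.mk_surjective m v
  rw [← map_smul, Values.subst_mk, Values.subst_mk, mapCoeff_smul, map_smul]

/-- The substitution `λ_k ↦ λ_{σ k}`. -/
noncomputable def Values.perm {n : ℕ} (σ : Equiv.Perm (Fin n)) : Values L n →ₗ[ℂ] Values L n :=
  Values.subst (MvPolynomial.rename σ) (by
    simp only [map_sum, MvPolynomial.rename_X]
    exact Equiv.sum_comp σ (fun k => (MvPolynomial.X k : MvPolynomial (Fin n) ℂ)))

/-- A `ℂ[∂]`-linear map `N` applied to all coefficients. -/
noncomputable def Values.map (N : L →ₗ[ℂ[X]] L) (n : ℕ) : Values L n →ₗ[ℂ] Values L n :=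
  Values.lift
    ((Values.mk n ∘ₗ (N.restrictScalars ℂ).baseChange (MvPolynomial (Fin n) ℂ)).restrictScalars ℂ)
    (fun u => by
      have : (N.restrictScalars ℂ).baseChange (MvPolynomial (Fin n) ℂ) (total L n u) =
          total L n ((N.restrictScalars ℂ).baseChange (MvPolynomial (Fin n) ℂ) u) := by
        simp only [total_apply, map_add, map_smul, baseChange_del_comm]
      simp [this, Values.mk_total])

theorem Values.map_mk (N : L →ₗ[ℂ[X]] L) (n : ℕ) (u : LPoly L n) :
    Values.map N n (Values.mk n u) =
      Values.mk n ((N.restrictScalars ℂ).baseChange (MvPolynomial (Fin n) ℂ) u) := rfl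

theorem Values.map_smul (N : L →ₗ[ℂ[X]] L) (n : ℕ) (P : MvPolynomial (Fin n) ℂ)
    (v : Values L n) : Values.map N n (P • v) = P • Values.map N n v := by
  obtain ⟨u, rfl⟩ := Values.mk_surjective n v
  rw [← _root_.map_smul, Values.map_mk, Values.map_mk, _root_.map_smul, _root_.map_smul]

theorem Values.map_perm (N : L →ₗ[ℂ[X]] L) (n : ℕ) (σ : Equiv.Perm (Fin n))
    (v : Values L n) : Values.map N n (Values.perm σ v) = Values.perm σ (Values.map N n v) := by
  obtain ⟨u, rfl⟩ := Values.mk_surjective n v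
  rw [Values.map_mk, Values.perm, Values.subst_mk, Values.map_mk, Values.subst_mk,
    mapCoeff_baseChange]

theorem SesquilinearBracket.extend_total (B : SesquilinearBracket L) {n : ℕ} (i : Fin (n + 1))
    (p : L) (u : LPoly L n) :
    extend B.bracket (MvPolynomial.X i) (1 ⊗ₜ p)
        (mapCoeff (MvPolynomial.rename i.succAbove) (total L n u)) =
      total L (n + 1) (extend B.bracket (MvPolynomial.X i) (1 ⊗ₜ p)
        (mapCoeff (MvPolynomial.rename i.succAbove) u)) := by
  rw [total_apply, total_apply, LinearMap.map_add, mapCoeff_baseChange, mapCoeff_smul,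
    LinearMap.map_add, B.extend_del_right, LinearMap.map_smul, map_sum,
    Fin.sum_univ_succAbove _ i, add_smul, add_assoc]
  simp only [MvPolynomial.rename_X]

/-- For `p : L`, the map `u ↦ [p_{λ_i} u]`, where `u` is a value of an `n`-cochain, written in the
variables `λ_0, …, λ_n` without `λ_i`. -/
noncomputable def SesquilinearBracket.act (B : SesquilinearBracket L) {n : ℕ} (i : Fin (n + 1)) :
    L →ₗ[ℂ] Values L n →ₗ[ℂ] Values L (n + 1) where
  toFun p := Values.lift
    (((Values.mk (n + 1)) ∘ₗ extend B.bracket (MvPolynomial.X i) (1 ⊗ₜ p)).restrictScalars ℂ ∘ₗ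
      mapCoeff (MvPolynomial.rename i.succAbove)) (fun u => by
        rw [LinearMap.comp_apply, LinearMap.restrictScalars_apply, LinearMap.comp_apply,
          B.extend_total, Values.mk_total])
  map_add' p q := LinearMap.ext fun v => by
    obtain ⟨u, rfl⟩ := Values.mk_surjective n v
    simp only [LinearMap.add_apply, Values.lift_mk, LinearMap.comp_apply,
      LinearMap.restrictScalars_apply, TensorProduct.tmul_add, LinearMap.map_add]
  map_smul' c p := LinearMap.ext fun v => by
    obtain ⟨u, rfl⟩ := Values.mk_surjective n v
    simp only [LinearMap.smul_apply, Values.lift_mk, LinearMap.comp_apply, RingHom.id_apply,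
      LinearMap.restrictScalars_apply, TensorProduct.tmul_smul, LinearMap.map_smul_of_tower]

theorem SesquilinearBracket.act_mk (B : SesquilinearBracket L) {n : ℕ} (i : Fin (n + 1)) (p : L)
    (u : LPoly L n) : B.act i p (Values.mk n u) = Values.mk (n + 1)
      (extend B.bracket (MvPolynomial.X i) (1 ⊗ₜ p)
        (mapCoeff (MvPolynomial.rename i.succAbove) u)) := rfl

theorem SesquilinearBracket.act_smul (B : SesquilinearBracket L) {n : ℕ} (i : Fin (n + 1)) (p : L)
    (P : MvPolynomial (Fin n) ℂ) (v : Values L n) :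
    B.act i p (P • v) = MvPolynomial.rename i.succAbove P • B.act i p v := by
  obtain ⟨u, rfl⟩ := Values.mk_surjective n v
  rw [← map_smul, B.act_mk, B.act_mk, mapCoeff_smul, map_smul, map_smul]

theorem SesquilinearBracket.act_del (B : SesquilinearBracket L) {n : ℕ} (i : Fin (n + 1)) (p : L)
    (v : Values L n) :
    B.act i (del L p) v = -((MvPolynomial.X i : MvPolynomial (Fin (n + 1)) ℂ) • B.act i p v) := by
  obtain ⟨u, rfl⟩ := Values.mk_surjective n v
  rw [B.act_mk, B.act_mk, ← map_smul, ← map_neg, ← B.extend_del_left]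
  simp

theorem SesquilinearBracket.perm_act (B : SesquilinearBracket L) {n : ℕ}
    (σ : Equiv.Perm (Fin (n + 1))) (τ : Equiv.Perm (Fin n)) (i : Fin (n + 1))
    (h : ∀ k, σ (i.succAbove k) = (σ i).succAbove (τ k)) (p : L) (v : Values L n) :
    Values.perm σ (B.act i p v) = B.act (σ i) p (Values.perm τ v) := by
  obtain ⟨u, rfl⟩ := Values.mk_surjective n v
  have e : (MvPolynomial.rename σ).comp (MvPolynomial.rename (R := ℂ) i.succAbove) =
    (MvPolynomial.rename (σ i).succAbove).comp (MvPolynomial.rename τ) := by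
    ext k; simp [h]
  rw [B.act_mk, Values.perm, Values.perm, Values.subst_mk, Values.subst_mk, B.act_mk,
    mapCoeff_extend, mapCoeff_mapCoeff, mapCoeff_mapCoeff, e]
  simp

theorem exists_perm_succAbove {n : ℕ} (σ : Equiv.Perm (Fin (n + 1))) (i : Fin (n + 1)) :
    ∃ τ : Equiv.Perm (Fin n), (∀ k, σ (i.succAbove k) = (σ i).succAbove (τ k)) ∧
      ((Equiv.Perm.sign τ : ℤˣ) : ℤ) = Equiv.Perm.sign σ * (-1) ^ (i : ℕ) * (-1) ^ (σ i : ℕ) := by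
  let ρ : Equiv.Perm (Fin (n + 1)) := (σ i).cycleRange * σ * i.cycleRange.symm
  obtain ⟨⟨a, τ⟩, hτ⟩ := Equiv.Perm.decomposeFin.symm.surjective ρ
  have h0 : ρ 0 = 0 := by simp [ρ]
  have ha : a = 0 := by rw [← hτ] at h0; simpa using h0
  subst ha
  refine ⟨τ, fun k => ?_, ?_⟩
  · have : ρ k.succ = (τ k).succ := by rw [← hτ]; simp
    have h2 := congrArg (σ i).cycleRange.symm this
    simpa [ρ] using h2
  · have := congrArg Equiv.Perm.sign hτ
    rw [Equiv.Perm.decomposeFin.symm_sign] at this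
    simp only [if_true, one_mul] at this
    rw [this]
    simp [ρ, Fin.sign_cycleRange]
    ring

end Cochains

section Differentials
variable (L : Type*) [AddCommGroup L] [Module ℂ L] [Module ℂ[X] L] [IsScalarTower ℂ ℂ[X] L]

/-- The space `C^n(L, L)` of `n`-cochains: `ℂ`-multilinear maps
`f_{λ_0, …, λ_{n-1}} : L × … × L → L[λ_0, …, λ_{n-1}] / (∂ + λ_0 + … + λ_{n-1})` that are conformally
sesquilinear, `f(…, ∂p_k, …) = -λ_k f(…, p_k, …)`, and conformally skew-symmetric,
`f_{λ_{σ 0}, λ_{σ 1}, …}(p_{σ 0}, p_{σ 1}, …) = sgn(σ) f_{λ_0, λ_1, …}(p_0, p_1, …)`. In degree `0`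
it is `L / ∂L`. -/
def Cochain (n : ℕ) : Submodule ℂ (MultilinearMap ℂ (fun _ : Fin n => L) (Values L n)) where
  carrier := {f |
    (∀ (p : Fin n → L) (k : Fin n), f (Function.update p k (del L (p k))) =
      -((MvPolynomial.X k : MvPolynomial (Fin n) ℂ) • f p)) ∧
    (∀ (σ : Equiv.Perm (Fin n)) (p : Fin n → L),
      Values.perm σ (f (p ∘ σ)) = (Equiv.Perm.sign σ : ℤ) • f p)}
  zero_mem' := by simp
  add_mem' {f g} hf hg := by
    refine ⟨fun p k => ?_, fun σ p => ?_⟩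
    · rw [add_apply, add_apply, hf.1, hg.1, smul_add, neg_add]
    · rw [add_apply, add_apply, map_add, hf.2, hg.2, smul_add]
  smul_mem' c f hf := by
    refine ⟨fun p k => ?_, fun σ p => ?_⟩
    · rw [smul_apply, smul_apply, hf.1, smul_neg, smul_comm]
    · rw [smul_apply, smul_apply, map_smul, hf.2, smul_comm]

variable {L}

/-- `(p_0, …, p_n) ↦ [(p_i)_{λ_i} f_{…, λ_i omitted, …}(…, p_i omitted, …)]`. -/
noncomputable def SesquilinearBracket.actTerm (B : SesquilinearBracket L) {n : ℕ}
    (i : Fin (n + 1)) (f : MultilinearMap ℂ (fun _ : Fin n => L) (Values L n)) :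
    MultilinearMap ℂ (fun _ : Fin (n + 1) => L) (Values L (n + 1)) :=
  LinearMap.uncurryMid (M := fun _ => L) i
    { toFun := fun x => (B.act i x).compMultilinearMap f
      map_add' := fun x y => by ext p; simp
      map_smul' := fun c x => by ext p; simp }

theorem SesquilinearBracket.actTerm_apply (B : SesquilinearBracket L) {n : ℕ}
    (i : Fin (n + 1)) (f : MultilinearMap ℂ (fun _ : Fin n => L) (Values L n))
    (p : Fin (n + 1) → L) :
    B.actTerm i f p = B.act i (p i) (f (fun k => p (i.succAbove k))) := rfl

/-- For `i' = j.succAbove i`, the substitution of `λ_{i'} + λ_j` for the first variable and of the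
`λ_k` with `k ≠ i', j`, in increasing order, for the other ones. -/
noncomputable def mergeVars {m : ℕ} (j : Fin (m + 2)) (i : Fin (m + 1)) :
    MvPolynomial (Fin (m + 1)) ℂ →ₐ[ℂ] MvPolynomial (Fin (m + 2)) ℂ :=
  MvPolynomial.aeval (Fin.cons (MvPolynomial.X (j.succAbove i) + MvPolynomial.X j)
    (fun k => MvPolynomial.X (j.succAbove (i.succAbove k))))

theorem mergeVars_sum {m : ℕ} (j : Fin (m + 2)) (i : Fin (m + 1)) :
    mergeVars j i (∑ k, MvPolynomial.X k) = ∑ k, MvPolynomial.X k := by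
  rw [map_sum, Fin.sum_univ_succ, Fin.sum_univ_succAbove _ j, Fin.sum_univ_succAbove _ i]
  simp only [mergeVars, MvPolynomial.aeval_X, Fin.cons_zero, Fin.cons_succ]
  ring

/-- For `z = ∑ λ^k c_k` in `L[λ]` and `i' = j.succAbove i`: the expression
`∑ a^k f_{λ_{i'} + λ_j, …, λ_{i'} omitted, …, λ_j omitted, …}(c_k, p)` as a function of `p`. -/
noncomputable def insertFirst {m : ℕ} (j : Fin (m + 2)) (i : Fin (m + 1))
    (a : MvPolynomial (Fin (m + 2)) ℂ)
    (f : MultilinearMap ℂ (fun _ : Fin (m + 1) => L) (Values L (m + 1))) :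
    ℂ[X] ⊗[ℂ] L →ₗ[ℂ] MultilinearMap ℂ (fun _ : Fin m => L) (Values L (m + 2)) :=
  TensorProduct.lift (LinearMap.mk₂ ℂ
    (fun P c => (Algebra.lsmul ℂ ℂ (Values L (m + 2)) (Polynomial.aeval a P) ∘ₗ
      Values.subst (mergeVars j i) (mergeVars_sum j i)).compMultilinearMap (f.curryLeft c))
    (fun P Q c => by ext p; simp) (fun r P c => by ext p; simp)
    (fun P c d => by ext p; simp)
    (fun r P c => by
      ext p
      simp only [map_smul, LinearMap.compMultilinearMap_apply, smul_apply,
        LinearMap.comp_apply]))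

theorem insertFirst_tmul {m : ℕ} (j : Fin (m + 2)) (i : Fin (m + 1))
    (a : MvPolynomial (Fin (m + 2)) ℂ)
    (f : MultilinearMap ℂ (fun _ : Fin (m + 1) => L) (Values L (m + 1)))
    (P : ℂ[X]) (c : L) (p : Fin m → L) :
    insertFirst j i a f (P ⊗ₜ c) p = Polynomial.aeval a P •
      Values.subst (mergeVars j i) (mergeVars_sum j i) (f (Fin.cons c p)) := rfl

/-- For `i' = j.succAbove i` (which is `i` itself when `i < j`), the map that sends `(p_0, …, p_n)`
to `f_{λ_{i'} + λ_j, …}([(p_{i'})_{λ_{i'}} p_j], …)`, the dots standing for the other variables and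
arguments in increasing order. -/
noncomputable def SesquilinearBracket.bracketTerm (B : SesquilinearBracket L) {m : ℕ}
    (j : Fin (m + 2)) (i : Fin (m + 1))
    (f : MultilinearMap ℂ (fun _ : Fin (m + 1) => L) (Values L (m + 1))) :
    MultilinearMap ℂ (fun _ : Fin (m + 2) => L) (Values L (m + 2)) :=
  LinearMap.uncurryMid (M := fun _ => L) j
    { toFun := fun y => LinearMap.uncurryMid (M := fun _ => L) i
        (insertFirst j i (MvPolynomial.X (j.succAbove i)) f ∘ₗ B.bracket.flip y)
      map_add' := fun x y => by ext p; simp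
      map_smul' := fun c x => by ext p; simp }

theorem SesquilinearBracket.bracketTerm_apply (B : SesquilinearBracket L) {m : ℕ}
    (j : Fin (m + 2)) (i : Fin (m + 1))
    (f : MultilinearMap ℂ (fun _ : Fin (m + 1) => L) (Values L (m + 1))) (p : Fin (m + 2) → L) :
    B.bracketTerm j i f p =
      insertFirst j i (MvPolynomial.X (j.succAbove i)) f
        (B.bracket (p (j.succAbove i)) (p j)) (fun k => p (j.succAbove (i.succAbove k))) := rfl

/-- `∑_i (-1)^i [(p_i)_{λ_i} f(…, p_i omitted, …)]`, with `i` counted from `0`. -/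
noncomputable def SesquilinearBracket.actSum (B : SesquilinearBracket L) {n : ℕ}
    (f : MultilinearMap ℂ (fun _ : Fin n => L) (Values L n)) :
    MultilinearMap ℂ (fun _ : Fin (n + 1) => L) (Values L (n + 1)) :=
  ∑ i : Fin (n + 1), ((-1 : ℤ) ^ (i : ℕ)) • B.actTerm i f

/-- `∑_{i<j} (-1)^{i+j} f_{λ_i + λ_j, …}([(p_i)_{λ_i} p_j], …)`, with `i`, `j` counted from `0`. -/
noncomputable def SesquilinearBracket.bracketSum (B : SesquilinearBracket L) :
    {n : ℕ} → MultilinearMap ℂ (fun _ : Fin n => L) (Values L n) →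
      MultilinearMap ℂ (fun _ : Fin (n + 1) => L) (Values L (n + 1))
  | 0, _ => 0
  | m + 1, f => ∑ j : Fin (m + 2), ∑ i : Fin (m + 1) with i.castSucc < j,
      ((-1 : ℤ) ^ ((i : ℕ) + (j : ℕ))) • B.bracketTerm j i f

theorem SesquilinearBracket.actSum_apply (B : SesquilinearBracket L) {n : ℕ}
    (f : MultilinearMap ℂ (fun _ : Fin n => L) (Values L n)) (p : Fin (n + 1) → L) :
    B.actSum f p = ∑ i : Fin (n + 1), ((-1 : ℤ) ^ (i : ℕ)) • B.actTerm i f p := by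
  simp [actSum]

theorem SesquilinearBracket.actSum_mem (B : SesquilinearBracket L) {n : ℕ}
    {f : MultilinearMap ℂ (fun _ : Fin n => L) (Values L n)} (hf : f ∈ Cochain L n) :
    B.actSum f ∈ Cochain L (n + 1) := by
  refine ⟨fun p k => ?_, fun σ p => ?_⟩
  · rw [B.actSum_apply, B.actSum_apply, Finset.smul_sum, ← Finset.sum_neg_distrib]
    refine Finset.sum_congr rfl fun i _ => ?_
    rw [smul_comm (MvPolynomial.X k : MvPolynomial (Fin (n + 1)) ℂ), ← smul_neg]
    congr 1
    rw [B.actTerm_apply, B.actTerm_apply]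
    rcases eq_or_ne k i with rfl | hki
    · simp [B.act_del]
    · obtain ⟨l, rfl⟩ := Fin.exists_succAbove_eq hki
      have h : (fun q => Function.update p (i.succAbove l) (del L (p (i.succAbove l)))
          (i.succAbove q)) = Function.update (fun q => p (i.succAbove q)) l
            (del L (p (i.succAbove l))) := by
        ext q; simp [Function.update_apply]
      rw [h, hf.1 (fun q => p (i.succAbove q)) l, Function.update_of_ne (Fin.succAbove_ne i l).symm, map_neg, B.act_smul,
        MvPolynomial.rename_X]
  · rw [B.actSum_apply, B.actSum_apply, map_sum, Finset.smul_sum,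
      ← Equiv.sum_comp σ (fun i => (Equiv.Perm.sign σ : ℤ) • ((-1 : ℤ) ^ (i : ℕ)) • B.actTerm i f p)]
    refine Finset.sum_congr rfl fun i _ => ?_
    obtain ⟨τ, h1, h2⟩ := exists_perm_succAbove σ i
    rw [B.actTerm_apply, B.actTerm_apply, map_zsmul, B.perm_act σ τ i h1]
    have e : (fun k => (p ∘ σ) (i.succAbove k)) = (fun k => p ((σ i).succAbove k)) ∘ τ := by
      ext k; simp [h1]
    rw [e, hf.2, map_zsmul, Function.comp_apply, smul_smul, smul_smul, h2]
    congr 1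
    have : ((-1 : ℤ) ^ (i : ℕ)) * (-1) ^ (i : ℕ) = 1 := by rw [← mul_pow]; simp
    linear_combination ((Equiv.Perm.sign σ : ℤ) * (-1) ^ (σ i : ℕ)) * this

theorem subst_congr {m n : ℕ} {e e' : MvPolynomial (Fin m) ℂ →ₐ[ℂ] MvPolynomial (Fin n) ℂ}
    (h : e = e') (he : e (∑ k, MvPolynomial.X k) = ∑ k, MvPolynomial.X k)
    (he' : e' (∑ k, MvPolynomial.X k) = ∑ k, MvPolynomial.X k) (v : Values L m) :
    Values.subst e he v = Values.subst e' he' v := by subst h; rfl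

theorem mergeVars_swap {m : ℕ} (j : Fin (m + 2)) (i : Fin (m + 1)) :
    mergeVars (j.succAbove i) (i.predAbove j) = mergeVars j i := by
  simp only [mergeVars, Fin.succAbove_succAbove_predAbove,
    Fin.succAbove_succAbove_succAbove_predAbove,
    add_comm (MvPolynomial.X j : MvPolynomial (Fin (m + 2)) ℂ)]

theorem insertFirst_X_smul {m : ℕ} (j : Fin (m + 2)) (i : Fin (m + 1))
    (a : MvPolynomial (Fin (m + 2)) ℂ)
    (f : MultilinearMap ℂ (fun _ : Fin (m + 1) => L) (Values L (m + 1)))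
    (z : ℂ[X] ⊗[ℂ] L) (p : Fin m → L) :
    insertFirst j i a f ((Polynomial.X : ℂ[X]) • z) p = a • insertFirst j i a f z p := by
  induction z with
  | zero => simp
  | add x y hx hy => rw [smul_add, map_add, map_add, add_apply, add_apply, hx, hy, smul_add]
  | tmul P c =>
    rw [TensorProduct.smul_tmul', insertFirst_tmul, insertFirst_tmul, smul_smul]
    simp

theorem insertFirst_del {m : ℕ} (j : Fin (m + 2)) (i : Fin (m + 1))
    (a : MvPolynomial (Fin (m + 2)) ℂ)
    {f : MultilinearMap ℂ (fun _ : Fin (m + 1) => L) (Values L (m + 1))}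
    (hf : f ∈ Cochain L (m + 1)) (z : ℂ[X] ⊗[ℂ] L) (p : Fin m → L) :
    insertFirst j i a f ((del L).baseChange ℂ[X] z) p =
      -((MvPolynomial.X (j.succAbove i) + MvPolynomial.X j : MvPolynomial (Fin (m + 2)) ℂ) •
        insertFirst j i a f z p) := by
  induction z with
  | zero => simp
  | add x y hx hy => rw [map_add, map_add, map_add, add_apply, add_apply, hx, hy, smul_add, neg_add]
  | tmul P c =>
    have h := hf.1 (Fin.cons c p) 0
    rw [Fin.update_cons_zero, Fin.cons_zero] at h
    rw [LinearMap.baseChange_tmul, insertFirst_tmul, insertFirst_tmul, h, map_neg, smul_neg,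
      Values.subst_smul, smul_comm]
    simp [mergeVars]

theorem insertFirst_dagger {m : ℕ} (j : Fin (m + 2)) (i : Fin (m + 1))
    {f : MultilinearMap ℂ (fun _ : Fin (m + 1) => L) (Values L (m + 1))}
    (hf : f ∈ Cochain L (m + 1)) (z : ℂ[X] ⊗[ℂ] L) (p : Fin m → L) :
    insertFirst j i (MvPolynomial.X j) f (dagger L z) p =
      insertFirst j i (MvPolynomial.X (j.succAbove i)) f z p := by
  induction z with
  | zero => simp
  | add x y hx hy => rw [map_add, map_add, map_add, add_apply, add_apply, hx, hy]
  | tmul P c =>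
    rw [dagger, TensorProduct.lift.tmul, LinearMap.mk₂_apply]
    set D : Module.End ℂ (ℂ[X] ⊗[ℂ] L) :=
      -(Polynomial.X : ℂ[X]) • (LinearMap.id : ℂ[X] ⊗[ℂ] L →ₗ[ℂ] ℂ[X] ⊗[ℂ] L)
        - ((del L).baseChange ℂ[X]).restrictScalars ℂ with hD
    have hDz : ∀ z, insertFirst j i (MvPolynomial.X j) f (D z) p =
        (MvPolynomial.X (j.succAbove i) : MvPolynomial (Fin (m + 2)) ℂ) •
          insertFirst j i (MvPolynomial.X j) f z p := fun z => by
      have : D z = -((Polynomial.X : ℂ[X]) • z + (del L).baseChange ℂ[X] z) := by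
        simp [hD]; abel
      rw [this, map_neg, map_add, neg_apply, add_apply, insertFirst_X_smul,
        insertFirst_del j i _ hf, add_smul]
      abel
    induction P using Polynomial.induction_on' with
    | add P Q hP hQ =>
      rw [map_add, LinearMap.add_apply, map_add, add_apply, hP, hQ, TensorProduct.add_tmul,
        map_add, add_apply]
    | monomial n r =>
      rw [Polynomial.aeval_monomial, Module.End.mul_apply, Module.algebraMap_end_apply, map_smul,
        smul_apply]
      have : insertFirst j i (MvPolynomial.X j) f ((D ^ n) (1 ⊗ₜ c)) p =
          (MvPolynomial.X (j.succAbove i) : MvPolynomial (Fin (m + 2)) ℂ) ^ n •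
            insertFirst j i (MvPolynomial.X j) f (1 ⊗ₜ c) p := by
        induction n with
        | zero => simp
        | succ n ih => rw [pow_succ', Module.End.mul_apply, hDz, ih, smul_smul, ← pow_succ']
      rw [this, insertFirst_tmul, insertFirst_tmul, Polynomial.aeval_monomial, map_one, one_smul,
        ← Algebra.smul_def, smul_assoc]

theorem LieConformalAlgebra.bracketTerm_swap (A : LieConformalAlgebra L) {m : ℕ}
    (j : Fin (m + 2)) (i : Fin (m + 1))
    {f : MultilinearMap ℂ (fun _ : Fin (m + 1) => L) (Values L (m + 1))}
    (hf : f ∈ Cochain L (m + 1)) (p : Fin (m + 2) → L) :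
    A.bracketTerm (j.succAbove i) (i.predAbove j) f p = -A.bracketTerm j i f p := by
  have e : ∀ a z q, insertFirst (j.succAbove i) (i.predAbove j) a f z q =
      insertFirst j i a f z q := fun a z q => by
    induction z with
    | zero => simp
    | add x y hx hy => rw [map_add, map_add, add_apply, add_apply, hx, hy]
    | tmul P c =>
      rw [insertFirst_tmul, insertFirst_tmul]
      exact congrArg _ (subst_congr (mergeVars_swap j i) _ _ _)
  rw [SesquilinearBracket.bracketTerm_apply, SesquilinearBracket.bracketTerm_apply, e]
  simp only [Fin.succAbove_succAbove_predAbove, Fin.succAbove_succAbove_succAbove_predAbove]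
  rw [A.skew (p j), map_neg, neg_apply, insertFirst_dagger j i hf]

theorem insertFirst_perm {m : ℕ} (σ : Equiv.Perm (Fin (m + 2))) (j : Fin (m + 2))
    (i : Fin (m + 1)) (τ : Equiv.Perm (Fin (m + 1))) (ρ : Equiv.Perm (Fin m))
    (hτ : ∀ k, σ (j.succAbove k) = (σ j).succAbove (τ k))
    (hρ : ∀ k, τ (i.succAbove k) = (τ i).succAbove (ρ k))
    {f : MultilinearMap ℂ (fun _ : Fin (m + 1) => L) (Values L (m + 1))}
    (hf : f ∈ Cochain L (m + 1)) (a : MvPolynomial (Fin (m + 2)) ℂ) (z : ℂ[X] ⊗[ℂ] L)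
    (p : Fin m → L) :
    Values.perm σ (insertFirst j i a f z (p ∘ ρ)) =
      (Equiv.Perm.sign ρ : ℤ) •
        insertFirst (σ j) (τ i) (MvPolynomial.rename σ a) f z p := by
  induction z with
  | zero => simp
  | add x y hx hy => rw [map_add, map_add, add_apply, add_apply, map_add, hx, hy, smul_add]
  | tmul P c =>
    let ρ' := Equiv.Perm.decomposeFin.symm (0, ρ)
    have hs : Equiv.Perm.sign ρ' = Equiv.Perm.sign ρ := by
      simp [ρ', Equiv.Perm.decomposeFin.symm_sign]
    have h0 : ρ' 0 = 0 := by simp [ρ']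
    have h1 : ∀ k, ρ' (Fin.succ k) = (ρ k).succ := by simp [ρ']
    have hc : (Fin.cons c (p ∘ ρ) : Fin (m + 1) → L) = (Fin.cons c p : Fin (m + 1) → L) ∘ ρ' := by
      ext k
      refine Fin.cases ?_ (fun k => ?_) k <;> simp [h0, h1]
    have he : (MvPolynomial.rename σ).comp (mergeVars j i) =
        (mergeVars (σ j) (τ i)).comp (MvPolynomial.rename ρ') := by
      ext1 k
      refine Fin.cases ?_ (fun k => ?_) k <;> simp [mergeVars, h0, h1, hτ, hρ]
    have key : ∀ v : Values L (m + 1),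
        Values.perm σ (Values.subst (mergeVars j i) (mergeVars_sum j i) v) =
          Values.subst (mergeVars (σ j) (τ i)) (mergeVars_sum _ _) (Values.perm ρ' v) := fun v => by
      obtain ⟨u, rfl⟩ := Values.mk_surjective _ v
      rw [Values.perm, Values.perm, Values.subst_mk, Values.subst_mk, Values.subst_mk,
        Values.subst_mk, mapCoeff_mapCoeff, mapCoeff_mapCoeff, he]
    have ha : MvPolynomial.rename σ (Polynomial.aeval a P) =
        Polynomial.aeval (MvPolynomial.rename σ a) P := by
      rw [Polynomial.aeval_algHom_apply]
    rw [insertFirst_tmul, insertFirst_tmul, Values.perm, Values.subst_smul, ← Values.perm, key,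
      hc, hf.2, map_zsmul, hs, ha, smul_comm]

theorem insertFirst_smul_of_update {m : ℕ} (j : Fin (m + 2)) (i : Fin (m + 1))
    (a : MvPolynomial (Fin (m + 2)) ℂ)
    {f : MultilinearMap ℂ (fun _ : Fin (m + 1) => L) (Values L (m + 1))}
    (hf : f ∈ Cochain L (m + 1)) (z : ℂ[X] ⊗[ℂ] L) (p : Fin m → L) (k : Fin m) :
    insertFirst j i a f z (Function.update p k (del L (p k))) =
      -((MvPolynomial.X (j.succAbove (i.succAbove k)) : MvPolynomial (Fin (m + 2)) ℂ) •
        insertFirst j i a f z p) := by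
  induction z with
  | zero => simp
  | add x y hx hy => rw [map_add, add_apply, add_apply, hx, hy, smul_add, neg_add]
  | tmul P c =>
    have h := hf.1 (Fin.cons c p) k.succ
    rw [← Fin.cons_update, Fin.cons_succ] at h
    rw [insertFirst_tmul, insertFirst_tmul, h, map_neg, smul_neg, Values.subst_smul, smul_comm]
    simp [mergeVars]

theorem SesquilinearBracket.bracketTerm_del (B : SesquilinearBracket L) {m : ℕ}
    (j : Fin (m + 2)) (i : Fin (m + 1))
    {f : MultilinearMap ℂ (fun _ : Fin (m + 1) => L) (Values L (m + 1))}
    (hf : f ∈ Cochain L (m + 1)) (p : Fin (m + 2) → L) (k : Fin (m + 2)) :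
    B.bracketTerm j i f (Function.update p k (del L (p k))) =
      -((MvPolynomial.X k : MvPolynomial (Fin (m + 2)) ℂ) • B.bracketTerm j i f p) := by
  rw [B.bracketTerm_apply, B.bracketTerm_apply]
  rcases eq_or_ne k j with rfl | hkj
  · simp only [Function.update_self, Fin.succAbove_ne, ne_eq, not_false_eq_true,
      Function.update_of_ne]
    rw [B.del_right, map_add, add_apply, insertFirst_X_smul, insertFirst_del _ _ _ hf, add_smul]
    abel
  · obtain ⟨l, rfl⟩ := Fin.exists_succAbove_eq hkj
    rw [Function.update_of_ne (Fin.succAbove_ne j l).symm]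
    rcases eq_or_ne l i with rfl | hli
    · have h : (fun q => Function.update p (j.succAbove l) (del L (p (j.succAbove l)))
          (j.succAbove (l.succAbove q))) = fun q => p (j.succAbove (l.succAbove q)) := by
        ext q; simp
      rw [h, Function.update_self, B.del_left, map_neg, neg_apply, insertFirst_X_smul]
    · obtain ⟨q, rfl⟩ := Fin.exists_succAbove_eq hli
      have h : (fun r => Function.update p (j.succAbove (i.succAbove q))
          (del L (p (j.succAbove (i.succAbove q)))) (j.succAbove (i.succAbove r))) =
          Function.update (fun r => p (j.succAbove (i.succAbove r))) q
            (del L (p (j.succAbove (i.succAbove q)))) := by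
        ext r; simp [Function.update_apply]
      rw [h, Function.update_of_ne (by simp),
        insertFirst_smul_of_update j i _ hf _ (fun r => p (j.succAbove (i.succAbove r))) q]

/-- Twice the sum over `i < j` is the sum over all pairs of distinct indices. -/
theorem LieConformalAlgebra.two_bracketSum (A : LieConformalAlgebra L) {m : ℕ}
    {f : MultilinearMap ℂ (fun _ : Fin (m + 1) => L) (Values L (m + 1))}
    (hf : f ∈ Cochain L (m + 1)) :
    (2 : ℂ) • A.bracketSum f = ∑ j : Fin (m + 2), ∑ i : Fin (m + 1),
      ((-1 : ℤ) ^ ((i : ℕ) + (j : ℕ))) • A.bracketTerm j i f := by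
  have hsplit : ∀ j : Fin (m + 2), ∑ i : Fin (m + 1),
      ((-1 : ℤ) ^ ((i : ℕ) + (j : ℕ))) • A.bracketTerm j i f =
      (∑ i : Fin (m + 1) with i.castSucc < j,
        ((-1 : ℤ) ^ ((i : ℕ) + (j : ℕ))) • A.bracketTerm j i f) +
      ∑ i : Fin (m + 1) with ¬ i.castSucc < j,
        ((-1 : ℤ) ^ ((i : ℕ) + (j : ℕ))) • A.bracketTerm j i f := fun j =>
    (Finset.sum_filter_add_sum_filter_not _ _ _).symm
  simp only [hsplit]
  rw [Finset.sum_add_distrib, two_smul, SesquilinearBracket.bracketSum]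
  congr 1
  rw [Finset.sum_sigma', Finset.sum_sigma']
  have inv : ∀ (j : Fin (m + 2)) (i : Fin (m + 1)),
      (i.predAbove j).predAbove (j.succAbove i) = i := fun j i => by
    simp [Fin.predAbove_predAbove_succAbove]
  refine Finset.sum_nbij' (fun x => ⟨x.1.succAbove x.2, x.2.predAbove x.1⟩)
    (fun x => ⟨x.1.succAbove x.2, x.2.predAbove x.1⟩) ?_ ?_ ?_ ?_ ?_
  · rintro ⟨j, i⟩ h
    simp only [Finset.mem_sigma, Finset.mem_univ, Finset.mem_filter, true_and] at h ⊢
    rw [Fin.succAbove_of_castSucc_lt _ _ h, Fin.predAbove_of_castSucc_lt _ _ h]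
    simp only [Fin.lt_def, Fin.val_castSucc, Fin.val_pred] at h ⊢
    omega
  · rintro ⟨j, i⟩ h
    simp only [Finset.mem_sigma, Finset.mem_univ, Finset.mem_filter, true_and, not_lt] at h ⊢
    rw [Fin.succAbove_of_le_castSucc _ _ h, Fin.predAbove_of_le_castSucc _ _ h]
    simp only [Fin.lt_def, Fin.le_def, Fin.val_castSucc, Fin.coe_castPred, Fin.val_succ] at h ⊢
    omega
  · rintro ⟨j, i⟩ h
    simp only [Fin.succAbove_succAbove_predAbove, inv]
  · rintro ⟨j, i⟩ h
    simp only [Fin.succAbove_succAbove_predAbove, inv]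
  · rintro ⟨j, i⟩ h
    ext p
    rw [smul_apply, smul_apply, A.bracketTerm_swap j i hf, smul_neg, ← neg_smul,
      add_comm (Fin.val _) (Fin.val (j.succAbove i)), Fin.neg_one_pow_succAbove_add_predAbove]
    simp [add_comm]

theorem LieConformalAlgebra.bracketSum_mem (A : LieConformalAlgebra L) {n : ℕ}
    {f : MultilinearMap ℂ (fun _ : Fin n => L) (Values L n)} (hf : f ∈ Cochain L n) :
    A.bracketSum f ∈ Cochain L (n + 1) := by
  cases n with
  | zero => exact zero_mem _
  | succ m =>
    suffices h : (2 : ℂ) • A.bracketSum f ∈ Cochain L (m + 2) by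
      have := (Cochain L (m + 2)).smul_mem (2 : ℂ)⁻¹ h
      rwa [smul_smul, inv_mul_cancel₀ two_ne_zero, one_smul] at this
    rw [A.two_bracketSum hf]
    have happ : ∀ p, (∑ j : Fin (m + 2), ∑ i : Fin (m + 1),
        ((-1 : ℤ) ^ ((i : ℕ) + (j : ℕ))) • A.bracketTerm j i f) p =
        ∑ j : Fin (m + 2), ∑ i : Fin (m + 1),
          ((-1 : ℤ) ^ ((i : ℕ) + (j : ℕ))) • A.bracketTerm j i f p := fun p => by simp
    refine ⟨fun p k => ?_, fun σ p => ?_⟩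
    · rw [happ, happ]
      simp only [Finset.smul_sum, ← Finset.sum_neg_distrib]
      refine Finset.sum_congr rfl fun j _ => Finset.sum_congr rfl fun i _ => ?_
      rw [A.bracketTerm_del j i hf, smul_neg, smul_comm]
    · rw [happ, happ, map_sum, Finset.smul_sum,
        ← Equiv.sum_comp σ (fun j => (Equiv.Perm.sign σ : ℤ) • ∑ i : Fin (m + 1),
          ((-1 : ℤ) ^ ((i : ℕ) + (j : ℕ))) • A.bracketTerm j i f p)]
      refine Finset.sum_congr rfl fun j _ => ?_
      obtain ⟨τ, hτ, hτs⟩ := exists_perm_succAbove σ j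
      rw [map_sum, Finset.smul_sum,
        ← Equiv.sum_comp τ (fun i => (Equiv.Perm.sign σ : ℤ) •
          ((-1 : ℤ) ^ ((i : ℕ) + (σ j : ℕ))) • A.bracketTerm (σ j) i f p)]
      refine Finset.sum_congr rfl fun i _ => ?_
      obtain ⟨ρ, hρ, hρs⟩ := exists_perm_succAbove τ i
      rw [A.bracketTerm_apply, A.bracketTerm_apply, map_zsmul]
      have e : (fun k => (p ∘ σ) (j.succAbove (i.succAbove k))) =
          (fun k => p ((σ j).succAbove ((τ i).succAbove k))) ∘ ρ := by
        ext k; simp [hτ, hρ]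
      rw [e, insertFirst_perm σ j i τ ρ hτ hρ hf, MvPolynomial.rename_X, hτ, Function.comp_apply,
        Function.comp_apply, hτ, smul_smul, smul_smul, hρs, hτs]
      congr 1
      have h1 : ((-1 : ℤ) ^ (i : ℕ)) * (-1) ^ (i : ℕ) = 1 := by rw [← mul_pow]; simp
      have h2 : ((-1 : ℤ) ^ (j : ℕ)) * (-1) ^ (j : ℕ) = 1 := by rw [← mul_pow]; simp
      rw [pow_add, pow_add]
      linear_combination ((Equiv.Perm.sign σ : ℤ) * (-1) ^ (σ j : ℕ) * (-1) ^ (τ i : ℕ)) *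
        ((-1 : ℤ) ^ (j : ℕ) * (-1) ^ (j : ℕ) * h1 + h2)

end Differentials

section Reduced
variable {L : Type*} [AddCommGroup L] [Module ℂ L] [Module ℂ[X] L] [IsScalarTower ℂ ℂ[X] L]

/-- The map `L[λ_1, …, λ_n] → Values L (n + 1)`; it is bijective. -/
noncomputable def Values.ofReduced (n : ℕ) : LPoly L n →ₗ[ℂ] Values L (n + 1) :=
  (Values.mk (n + 1)).restrictScalars ℂ ∘ₗ mapCoeff (MvPolynomial.rename Fin.castSucc)

theorem Values.ofReduced_apply (n : ℕ) (u : LPoly L n) : Values.ofReduced n u =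
    Values.mk (n + 1) (mapCoeff (MvPolynomial.rename Fin.castSucc) u) := rfl

theorem Values.ofReduced_surjective (n : ℕ) :
    Function.Surjective (Values.ofReduced (L := L) n) := by
  have hX : ∀ (k : Fin (n + 1)) (u : LPoly L n), ∃ w, Values.ofReduced n w =
      (MvPolynomial.X k : MvPolynomial (Fin (n + 1)) ℂ) • Values.ofReduced n u := by
    intro k u
    refine Fin.lastCases ?_ (fun k => ?_) k
    · refine ⟨-total L n u, ?_⟩
      have h := Values.mk_total (n + 1) (mapCoeff (MvPolynomial.rename Fin.castSucc) u)
      rw [total_apply, Fin.sum_univ_castSucc, add_smul, ← add_assoc] at h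
      rw [map_neg, Values.ofReduced_apply, Values.ofReduced_apply, ← _root_.map_smul, neg_eq_iff_add_eq_zero,
        ← map_add, ← h, total_apply, (mapCoeff (MvPolynomial.rename Fin.castSucc)).map_add,
        mapCoeff_baseChange, mapCoeff_smul, map_sum]
      simp only [MvPolynomial.rename_X]
    · refine ⟨(MvPolynomial.X k : MvPolynomial (Fin n) ℂ) • u, ?_⟩
      rw [Values.ofReduced_apply, Values.ofReduced_apply, ← _root_.map_smul, mapCoeff_smul,
        MvPolynomial.rename_X]
  intro v
  obtain ⟨u, rfl⟩ := Values.mk_surjective _ v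
  induction u using TensorProduct.induction_on with
  | zero => exact ⟨0, by simp⟩
  | add x y hx hy =>
    obtain ⟨a, ha⟩ := hx
    obtain ⟨b, hb⟩ := hy
    exact ⟨a + b, by rw [map_add, map_add, ha, hb]⟩
  | tmul P c =>
    induction P using MvPolynomial.induction_on with
    | C r => exact ⟨MvPolynomial.C r ⊗ₜ c, by simp [Values.ofReduced_apply]⟩
    | add P Q hP hQ =>
      obtain ⟨a, ha⟩ := hP
      obtain ⟨b, hb⟩ := hQ
      exact ⟨a + b, by rw [TensorProduct.add_tmul, map_add, map_add, ha, hb]⟩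
    | mul_X P k hP =>
      obtain ⟨a, ha⟩ := hP
      obtain ⟨w, hw⟩ := hX k a
      refine ⟨w, ?_⟩
      rw [hw, ha, ← _root_.map_smul, TensorProduct.smul_tmul', smul_eq_mul, mul_comm]

theorem Values.ofReduced_injective (n : ℕ) :
    Function.Injective (Values.ofReduced (L := L) n) := by
  let T : Module.End (MvPolynomial (Fin n) ℂ) (LPoly L n) := -total L n
  let φ : MvPolynomial (Fin (n + 1)) ℂ →ₐ[ℂ] Polynomial (MvPolynomial (Fin n) ℂ) :=
    (MvPolynomial.finSuccEquiv ℂ n).toAlgHom.comp (MvPolynomial.rename (finRotate (n + 1)))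
  have φc : ∀ k : Fin n, φ (MvPolynomial.X k.castSucc) = Polynomial.C (MvPolynomial.X k) := by
    intro k
    simp [φ, MvPolynomial.finSuccEquiv_X_succ]
  have φl : φ (MvPolynomial.X (Fin.last n)) = Polynomial.X := by
    simp [φ, MvPolynomial.finSuccEquiv_X_zero]
  have φr : ∀ Q, φ (MvPolynomial.rename Fin.castSucc Q) = Polynomial.C Q := by
    intro Q
    induction Q using MvPolynomial.induction_on with
    | C r => simp [φ]
    | add P Q hP hQ => simp [hP, hQ]
    | mul_X P k hP => simp [hP, φc]
  let elim : LPoly L (n + 1) →ₗ[ℂ] LPoly L n := TensorProduct.lift (LinearMap.mk₂ ℂ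
    (fun P c => Polynomial.aeval T (φ P) ((1 : MvPolynomial (Fin n) ℂ) ⊗ₜ[ℂ] c))
    (by simp) (by intro r P c; rw [_root_.map_smul, ← algebraMap_smul (MvPolynomial (Fin n) ℂ) r (φ P), _root_.map_smul,
        LinearMap.smul_apply, algebraMap_smul])
    (by simp [TensorProduct.tmul_add]) (by
      intro r P c; rw [TensorProduct.tmul_smul, LinearMap.map_smul_of_tower]))
  have helim : ∀ P c, elim (P ⊗ₜ c) =
      Polynomial.aeval T (φ P) ((1 : MvPolynomial (Fin n) ℂ) ⊗ₜ[ℂ] c) := fun _ _ => rfl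
  have h0 : ∀ u, elim (total L (n + 1) u) = 0 := by
    intro u
    induction u using TensorProduct.induction_on with
    | zero => simp
    | add x y hx hy => rw [map_add, map_add, hx, hy, add_zero]
    | tmul P c =>
      rw [total_apply, LinearMap.baseChange_tmul, TensorProduct.smul_tmul', map_add, helim, helim,
        smul_eq_mul, mul_comm, map_mul, Fin.sum_univ_castSucc, map_add φ, map_sum φ, φl, map_mul,
        Module.End.mul_apply, ← map_add]
      simp only [φc]
      rw [map_add (Polynomial.aeval T), map_sum]
      simp only [Polynomial.aeval_C, Polynomial.aeval_X]
      convert LinearMap.map_zero _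
      simp only [T, LinearMap.add_apply, LinearMap.neg_apply, total_apply, LinearMap.sum_apply,
        Module.algebraMap_end_apply, LinearMap.baseChange_tmul, Finset.sum_smul]
      abel
  have h1 : ∀ u, elim (mapCoeff (MvPolynomial.rename Fin.castSucc) u) = u := by
    intro u
    induction u using TensorProduct.induction_on with
    | zero => simp
    | add x y hx hy => rw [map_add, map_add, hx, hy]
    | tmul P c =>
      rw [mapCoeff_tmul, helim, φr, Polynomial.aeval_C, Module.algebraMap_end_apply,
        TensorProduct.smul_tmul', smul_eq_mul, mul_one]
  intro u v h
  have h' := congrArg (Values.lift elim h0) h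
  rwa [Values.ofReduced_apply, Values.ofReduced_apply, Values.lift_mk, Values.lift_mk, h1, h1] at h'

end Reduced

section Cohomology
variable {V : ℕ → Type*} [∀ n, AddCommGroup (V n)] [∀ n, Module ℂ (V n)]

/-- The coboundaries in degree `n`: the image of the incoming map (zero in degree `0`). -/
def coboundaries (D : ∀ n, V n →ₗ[ℂ] V (n + 1)) : ∀ n, Submodule ℂ (V n)
  | 0 => ⊥
  | n + 1 => LinearMap.range (D n)

/-- The cohomology in degree `n` of a sequence of maps `D n : V n → V (n + 1)`: cocycles modulo
those cocycles that are coboundaries. For a cochain complex all coboundaries are cocycles. -/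
def Cohomology (D : ∀ n, V n →ₗ[ℂ] V (n + 1)) (n : ℕ) : Type _ :=
  LinearMap.ker (D n) ⧸ (coboundaries D n).comap (LinearMap.ker (D n)).subtype

instance (D : ∀ n, V n →ₗ[ℂ] V (n + 1)) (n : ℕ) : AddCommGroup (Cohomology D n) :=
  inferInstanceAs
    (AddCommGroup (LinearMap.ker (D n) ⧸ (coboundaries D n).comap (LinearMap.ker (D n)).subtype))

noncomputable instance (D : ∀ n, V n →ₗ[ℂ] V (n + 1)) (n : ℕ) : Module ℂ (Cohomology D n) :=
  inferInstanceAs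
    (Module ℂ (LinearMap.ker (D n) ⧸ (coboundaries D n).comap (LinearMap.ker (D n)).subtype))

/-- The class of a cocycle. -/
def Cohomology.mk (D : ∀ n, V n →ₗ[ℂ] V (n + 1)) (n : ℕ) (f : V n) (hf : D n f = 0) :
    Cohomology D n :=
  Submodule.Quotient.mk (p := (coboundaries D n).comap (LinearMap.ker (D n)).subtype) ⟨f, hf⟩

end Cohomology

section Complexes
variable {L : Type*} [AddCommGroup L] [Module ℂ L] [Module ℂ[X] L] [IsScalarTower ℂ ℂ[X] L]

theorem SesquilinearBracket.actTerm_add (B : SesquilinearBracket L) {n : ℕ} (i : Fin (n + 1))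
    (f g : MultilinearMap ℂ (fun _ : Fin n => L) (Values L n)) :
    B.actTerm i (f + g) = B.actTerm i f + B.actTerm i g := by
  ext p; simp [actTerm_apply]

theorem SesquilinearBracket.actTerm_smul (B : SesquilinearBracket L) {n : ℕ} (i : Fin (n + 1))
    (c : ℂ) (f : MultilinearMap ℂ (fun _ : Fin n => L) (Values L n)) :
    B.actTerm i (c • f) = c • B.actTerm i f := by
  ext p; simp [actTerm_apply]

theorem insertFirst_add {m : ℕ} (j : Fin (m + 2)) (i : Fin (m + 1))
    (a : MvPolynomial (Fin (m + 2)) ℂ)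
    (f g : MultilinearMap ℂ (fun _ : Fin (m + 1) => L) (Values L (m + 1))) :
    insertFirst j i a (f + g) = insertFirst j i a f + insertFirst j i a g := by
  ext P c p
  simp [insertFirst_tmul]

theorem insertFirst_smul {m : ℕ} (j : Fin (m + 2)) (i : Fin (m + 1))
    (a : MvPolynomial (Fin (m + 2)) ℂ) (r : ℂ)
    (f : MultilinearMap ℂ (fun _ : Fin (m + 1) => L) (Values L (m + 1))) :
    insertFirst j i a (r • f) = r • insertFirst j i a f := by
  refine TensorProduct.ext' fun P c => ?_
  ext p
  rw [LinearMap.smul_apply, smul_apply, insertFirst_tmul, insertFirst_tmul, smul_apply, _root_.map_smul,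
    smul_comm]

theorem SesquilinearBracket.bracketSum_add (B : SesquilinearBracket L) {n : ℕ}
    (f g : MultilinearMap ℂ (fun _ : Fin n => L) (Values L n)) :
    B.bracketSum (f + g) = B.bracketSum f + B.bracketSum g := by
  cases n with
  | zero => simp [bracketSum]
  | succ m =>
    simp only [bracketSum, ← Finset.sum_add_distrib, ← smul_add]
    congr! 4
    ext p
    simp [bracketTerm_apply, insertFirst_add]

theorem SesquilinearBracket.bracketSum_smul (B : SesquilinearBracket L) {n : ℕ} (c : ℂ)
    (f : MultilinearMap ℂ (fun _ : Fin n => L) (Values L n)) :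
    B.bracketSum (c • f) = c • B.bracketSum f := by
  cases n with
  | zero => simp [bracketSum]
  | succ m =>
    simp only [bracketSum, Finset.smul_sum, smul_comm c]
    congr! 4
    ext p
    simp [bracketTerm_apply, insertFirst_smul]

/-- `actSum` as a map of cochains. -/
noncomputable def SesquilinearBracket.actMap (B : SesquilinearBracket L) (n : ℕ) :
    Cochain L n →ₗ[ℂ] Cochain L (n + 1) where
  toFun f := ⟨B.actSum f.1, B.actSum_mem f.2⟩
  map_add' f g := Subtype.ext (by
    simp [SesquilinearBracket.actSum, B.actTerm_add, Finset.sum_add_distrib])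
  map_smul' c f := Subtype.ext (by
    simp [SesquilinearBracket.actSum, B.actTerm_smul, Finset.smul_sum, smul_comm c])

/-- `bracketSum` as a map of cochains. -/
noncomputable def LieConformalAlgebra.bracketMap (A : LieConformalAlgebra L) (n : ℕ) :
    Cochain L n →ₗ[ℂ] Cochain L (n + 1) where
  toFun f := ⟨A.bracketSum f.1, A.bracketSum_mem f.2⟩
  map_add' f g := Subtype.ext (A.bracketSum_add f.1 g.1)
  map_smul' c f := Subtype.ext (A.bracketSum_smul c f.1)

/-- The map `f ↦ N ∘ f` on cochains. -/
noncomputable def postcomp (N : L →ₗ[ℂ[X]] L) (n : ℕ) : Cochain L n →ₗ[ℂ] Cochain L n where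
  toFun f := ⟨(Values.map N n).compMultilinearMap f.1, by
    refine ⟨fun p k => ?_, fun σ p => ?_⟩
    · rw [LinearMap.compMultilinearMap_apply, LinearMap.compMultilinearMap_apply, f.2.1, map_neg,
        Values.map_smul]
    · rw [LinearMap.compMultilinearMap_apply, LinearMap.compMultilinearMap_apply,
        ← Values.map_perm, f.2.2, map_zsmul]⟩
  map_add' f g := by ext p; simp
  map_smul' c f := by ext p; simp

/-- The coboundary operator `δ` of a Lie conformal algebra with coefficients in the adjoint
representation. -/
noncomputable def LieConformalAlgebra.coboundary (A : LieConformalAlgebra L) (n : ℕ) :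
    Cochain L n →ₗ[ℂ] Cochain L (n + 1) :=
  A.actMap n + A.bracketMap n

/-- The differential `d_N` of a Nijenhuis operator: for an `n`-cochain `f`,
`∑ (-1)^i [N(p_i)_{λ_i} f(…)] + ∑_{i<j} (-1)^{i+j} f_{λ_i + λ_j, …}([(p_i)_{λ_i} p_j]_N, …) - N(δ f)`. -/
noncomputable def LieConformalAlgebra.nijenhuisDifferential (A : LieConformalAlgebra L)
    (N : L →ₗ[ℂ[X]] L) (hN : A.IsNijenhuis N) (n : ℕ) :
    Cochain L n →ₗ[ℂ] Cochain L (n + 1) :=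
  (A.compLeft N).actMap n + (A.deformed N hN).bracketMap n - postcomp N (n + 1) ∘ₗ A.coboundary n

/-- The map `Φ^n(f) = (-1)^{n+1} δ f`, where `δ` is the coboundary operator of the original bracket. -/
noncomputable def LieConformalAlgebra.Phi (A : LieConformalAlgebra L) (n : ℕ) :
    Cochain L n →ₗ[ℂ] Cochain L (n + 1) :=
  ((-1 : ℤ) ^ (n + 1)) • A.coboundary n

end Complexes

end LieConformal

/-! Split `δ = a + b`, where `a f = ∑ ±[p_i, f(…)]` and `b f = ∑ ±f([p_i, p_j], …)`. Let `ν f = N ∘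
f`, let `s f = ∑_k f(…, N(p_k), …)` (`sumComp`), and let `D = d_N + νδ` (`mixedCoboundary`).
Expanding the definitions gives three identities: `bν = νb`, because `f` is outermost in every term
of `b`; `D = sδ - δs`; and `δ_N = D + aν - νa`, which by the first identity equals `D + δν - νδ`.
Once `δ² = 0` is known, the second identity gives `Dδ + δD = 0`, hence `δ_N δ = Dδ + δνδ - νδ² =
-δ(D - νδ) = -δ d_N`. The alternating sign in `Φ` turns this anticommutation into commutation, and a
map that intertwines the differentials descends to cohomology.

The remaining work is `δ² = 0` for conformal cochains (`coboundary_coboundary`). The formal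
variables are removed by letting every argument carry its own `λ`: over a commutative algebra `R`, a
pair `(a, u)` in `R × (R ⊗ L)` is a homogeneous element of degree `a`, the bracket is `[(a, u), (b,
v)] = (a + b, [u_a v])`, and these elements act on `⨁_c (R ⊗ L)/(∂ + c)` with `[u_a ·]` raising
degree by `a`. A cochain then becomes an ordinary skew-symmetric function of homogeneous elements
(`evalCochain`), and nothing is lost when `R` is the polynomial ring in the `λ`s
(`evalCochain_injective`). Under this evaluation `δ` becomes the Chevalley–Eilenberg formula, which
on skew functions agrees with the operator `d` determined recursively by Cartan's formula `i_x d =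
L_x - d i_x` (`IsSkew.chevalleyD_eq`).

For that operator `d² = 0` follows by induction on the degree from `[L_x, L_y] = L_{[x,y]}` and
`[L_x, d] = 0`. Only the left Leibniz identity is used there, not skew-symmetry of the bracket.
Homogeneous elements of different degrees cannot be added, so that identity is imposed after
applying the function (`RespectsJacobi`) rather than in the set of arguments. -/

namespace LieConformal

/-! ### Cartan calculus for left Leibniz algebras -/

section Leibniz
variable {X T : Type*} [AddCommGroup T] (br : X → X → X) (act : X → T →+ T)

/-- The Lie derivative of a `T`-valued function of `n` arguments along `x`. -/
def lieDer (x : X) {n : ℕ} (F : (Fin n → X) → T) : (Fin n → X) → T :=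
  fun p => act x (F p) - ∑ k, F (Function.update p k (br x (p k)))

/-- Insertion of `x` as the first argument. -/
def contract {X T : Type*} (x : X) {n : ℕ} (F : (Fin (n + 1) → X) → T) : (Fin n → X) → T :=
  fun p => F (Fin.cons x p)

/-- The coboundary operator of a left Leibniz algebra, defined by Cartan's formula. -/
def leibnizD : {n : ℕ} → ((Fin n → X) → T) → (Fin (n + 1) → X) → T
  | 0, F => fun p => lieDer br act (p 0) F (Fin.tail p)
  | _ + 1, F => fun p =>
      lieDer br act (p 0) F (Fin.tail p) - leibnizD (contract (p 0) F) (Fin.tail p)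

/-- `F` respects the Jacobi identity in each of its arguments. -/
def RespectsJacobi {n : ℕ} (F : (Fin n → X) → T) : Prop :=
  ∀ (p : Fin n → X) (k : Fin n) (x y z : X), F (Function.update p k (br x (br y z))) =
    F (Function.update p k (br (br x y) z)) + F (Function.update p k (br y (br x z)))

theorem eq_of_contract_eq {X T : Type*} {n : ℕ} {F G : (Fin (n + 1) → X) → T}
    (h : ∀ x, contract x F = contract x G) : F = G := by
  funext p
  have := congrFun (h (p 0)) (Fin.tail p)
  simpa [contract] using this

theorem contract_sub (x : X) {n : ℕ} (F G : (Fin (n + 1) → X) → T) :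
    contract x (F - G) = contract x F - contract x G := rfl

theorem lieDer_sub (x : X) {n : ℕ} (F G : (Fin n → X) → T) :
    lieDer br act x (F - G) = lieDer br act x F - lieDer br act x G := by
  funext p
  simp only [lieDer, Pi.sub_apply, map_sub, Finset.sum_sub_distrib]
  abel

/-- Cartan's relation `[L_x, i_y] = i_{[x,y]}`: the summand of `L_x` that brackets `x` into the
inserted argument `y` is the correction term. -/
theorem contract_lieDer (x y : X) {n : ℕ} (F : (Fin (n + 1) → X) → T) :
    contract y (lieDer br act x F) =
      lieDer br act x (contract y F) - contract (br x y) F := by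
  funext p
  simp only [contract, lieDer, Pi.sub_apply, Fin.sum_univ_succ, Fin.cons_zero, Fin.cons_succ,
    Fin.update_cons_zero, Fin.cons_update]
  abel

theorem contract_leibnizD_zero (x : X) (F : (Fin 0 → X) → T) :
    contract x (leibnizD br act F) = lieDer br act x F := rfl

theorem contract_leibnizD (x : X) {n : ℕ} (F : (Fin (n + 1) → X) → T) :
    contract x (leibnizD br act F) =
      lieDer br act x F - leibnizD br act (contract x F) := rfl

theorem leibnizD_sub {n : ℕ} (F G : (Fin n → X) → T) :
    leibnizD br act (F - G) = leibnizD br act F - leibnizD br act G := by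
  induction n with
  | zero =>
    refine eq_of_contract_eq fun x => ?_
    simp only [contract_sub, contract_leibnizD_zero, lieDer_sub]
  | succ n ih =>
    refine eq_of_contract_eq fun x => ?_
    simp only [contract_sub, contract_leibnizD, lieDer_sub, ih]
    abel

variable {br act}

theorem RespectsJacobi.contract {n : ℕ} {F : (Fin (n + 1) → X) → T} (hF : RespectsJacobi br F)
    (w : X) : RespectsJacobi br (contract w F) := fun p k x y z => by
  simpa [LieConformal.contract, Fin.cons_update] using hF (Fin.cons w p) k.succ x y z

theorem RespectsJacobi.contract_br {n : ℕ} {F : (Fin (n + 1) → X) → T}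
    (hF : RespectsJacobi br F) (x y z : X) :
    LieConformal.contract (br x (br y z)) F =
      LieConformal.contract (br (br x y) z) F + LieConformal.contract (br y (br x z)) F := by
  funext p
  simpa [LieConformal.contract] using hF (Fin.cons x p) 0 x y z

/-- Induction on the degree: after contracting with `z`, the corrections from `contract_lieDer` that
do not cancel are contractions with `[x,[y,z]]`, `[[x,y],z]` and `[y,[x,z]]`, which balance by the
Jacobi identity. In degree `0` this is the module axiom `hact`. -/
theorem lieDer_lieDer
    (hact : ∀ x y t, act x (act y t) = act (br x y) t + act y (act x t))
    (x y : X) {n : ℕ} {F : (Fin n → X) → T} (hF : RespectsJacobi br F) :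
    lieDer br act x (lieDer br act y F) =
      lieDer br act (br x y) F + lieDer br act y (lieDer br act x F) := by
  induction n with
  | zero => funext p; simp [lieDer, hact x y]
  | succ n ih =>
    refine eq_of_contract_eq fun z => ?_
    have h1 := ih (hF.contract z)
    have h2 := hF.contract_br x y z
    have h3 : contract z (lieDer br act (br x y) F + lieDer br act y (lieDer br act x F)) =
      contract z (lieDer br act (br x y) F) + contract z (lieDer br act y (lieDer br act x F)) := rfl
    rw [h3]
    simp only [contract_lieDer, lieDer_sub, h1, h2]
    abel

/-- Contracting with `y` reduces `[d, L_x] = 0` to the same relation for `i_y F`, up to `L_x L_y -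
L_y L_x - L_{[x,y]}`, which vanishes. -/
theorem leibnizD_lieDer
    (hact : ∀ x y t, act x (act y t) = act (br x y) t + act y (act x t))
    (x : X) {n : ℕ} {F : (Fin n → X) → T} (hF : RespectsJacobi br F) :
    leibnizD br act (lieDer br act x F) = lieDer br act x (leibnizD br act F) := by
  induction n with
  | zero =>
    refine eq_of_contract_eq fun y => ?_
    rw [contract_leibnizD_zero, contract_lieDer, contract_leibnizD_zero, contract_leibnizD_zero,
      lieDer_lieDer hact x y hF]
    abel
  | succ n ih =>
    refine eq_of_contract_eq fun y => ?_
    simp only [contract_lieDer, contract_leibnizD, lieDer_sub, leibnizD_sub, ih (hF.contract y),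
      lieDer_lieDer hact x y hF]
    abel

/-- By Cartan's formula `i_y d² F = L_y dF - d(L_y F - d i_y F) = (L_y d - d L_y) F + d² i_y F`, and
the degree of `i_y F` is one lower. -/
theorem leibnizD_leibnizD
    (hact : ∀ x y t, act x (act y t) = act (br x y) t + act y (act x t))
    {n : ℕ} {F : (Fin n → X) → T} (hF : RespectsJacobi br F) :
    leibnizD br act (leibnizD br act F) = 0 := by
  induction n with
  | zero =>
    refine eq_of_contract_eq fun y => ?_
    rw [contract_leibnizD, contract_leibnizD_zero, leibnizD_lieDer hact y hF, sub_self]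
    rfl
  | succ n ih =>
    refine eq_of_contract_eq fun y => ?_
    rw [contract_leibnizD, contract_leibnizD, leibnizD_sub, leibnizD_lieDer hact y hF,
      ih (hF.contract y)]
    simp
    rfl

end Leibniz

/-! ### The Chevalley–Eilenberg formula on skew-symmetric functions -/

section ChevalleyEilenberg
variable {X T : Type*} [AddCommGroup T] (br : X → X → X) (act : X → T →+ T)

/-- `∑_{i<j} (-1)^{i+j} F([p_i, p_j], …)`. -/
def bracketD : {n : ℕ} → ((Fin n → X) → T) → (Fin (n + 1) → X) → T
  | 0, _ => 0
  | m + 1, F => fun p => ∑ j : Fin (m + 2), ∑ i : Fin (m + 1) with i.castSucc < j,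
      ((-1 : ℤ) ^ ((i : ℕ) + (j : ℕ))) • F (Fin.cons (br (p (j.succAbove i)) (p j))
        (fun k => p (j.succAbove (i.succAbove k))))

/-- The Chevalley–Eilenberg formula for the coboundary operator. -/
def chevalleyD {n : ℕ} (F : (Fin n → X) → T) : (Fin (n + 1) → X) → T := fun p =>
  ∑ i : Fin (n + 1), ((-1 : ℤ) ^ (i : ℕ)) • act (p i) (F fun k => p (i.succAbove k)) +
    bracketD br F p

/-- `F` is skew-symmetric in its arguments. -/
def IsSkew {n : ℕ} (F : (Fin n → X) → T) : Prop :=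
  ∀ (σ : Equiv.Perm (Fin n)) (p : Fin n → X), F (p ∘ σ) = (Equiv.Perm.sign σ : ℤ) • F p

variable {br act}

theorem IsSkew.contract {n : ℕ} {F : (Fin (n + 1) → X) → T} (hF : IsSkew F) (x : X) :
    IsSkew (contract x F) := fun σ p => by
  -- `σ` extended to the longer tuple so as to fix the inserted first argument.
  let σ' := Equiv.Perm.decomposeFin.symm (0, σ)
  have hs : Equiv.Perm.sign σ' = Equiv.Perm.sign σ := by
    simp [σ', Equiv.Perm.decomposeFin.symm_sign]
  have hc : (Fin.cons x (p ∘ σ) : Fin (n + 1) → X) = (Fin.cons x p : Fin (n + 1) → X) ∘ σ' := by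
    ext k
    refine Fin.cases ?_ (fun k => ?_) k <;> simp [σ']
  rw [LieConformal.contract, LieConformal.contract, hc, hF, hs]

/-- Moving an argument from the front to slot `k` is a cycle of length `k + 1`, of sign `(-1)^k`. -/
theorem IsSkew.cons_removeNth {n : ℕ} {F : (Fin (n + 1) → X) → T} (hF : IsSkew F)
    (p : Fin (n + 1) → X) (k : Fin (n + 1)) (z : X) :
    F (Fin.cons z (fun l => p (k.succAbove l))) =
      ((-1 : ℤ) ^ (k : ℕ)) • F (Function.update p k z) := by
  have h : (Function.update p k z : Fin (n + 1) → X) =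
      k.insertNth z (fun l => p (k.succAbove l)) := by
    ext l
    rcases eq_or_ne l k with rfl | hl
    · simp
    · obtain ⟨l, rfl⟩ := Fin.exists_succAbove_eq hl
      simp
  rw [h, ← Fin.insertNth_comp_cycleRange_symm k, hF]
  simp [Fin.sign_cycleRange]

theorem IsSkew.cons_cons {n : ℕ} {F : (Fin (n + 2) → X) → T} (hF : IsSkew F)
    (q : Fin n → X) (x y : X) :
    F (Fin.cons x (Fin.cons y q)) = -F (Fin.cons y (Fin.cons x q)) := by
  have h := hF.cons_removeNth (Fin.cons y (Fin.cons x q)) 1 x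
  have h1 : (fun l => (Fin.cons y (Fin.cons x q) : Fin (n + 2) → X) ((1 : Fin (n + 2)).succAbove l)) =
      (Fin.cons y q : Fin (n + 1) → X) := by
    ext l
    refine Fin.cases ?_ (fun l => ?_) l
    · simp
    · rw [← Fin.succ_zero_eq_one', Fin.succ_succAbove_succ]; simp
  have h2 : Function.update (Fin.cons y (Fin.cons x q) : Fin (n + 2) → X) 1 x =
      Fin.cons y (Fin.cons x q) := by
    rw [← Fin.succ_zero_eq_one', ← Fin.cons_update, Fin.update_cons_zero]
  rw [h1, h2] at h
  simpa using h

theorem cons_succ_succAbove {n : ℕ} (x : X) (q : Fin (n + 1) → X) (i : Fin (n + 1)) :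
    (fun k => (Fin.cons x q : Fin (n + 2) → X) (i.succ.succAbove k)) =
      Fin.cons x (fun k => q (i.succAbove k)) := by
  ext k
  refine Fin.cases ?_ (fun k => ?_) k <;> simp

/-- Separates the pairs `i < j` with `i = 0` from those with both indices positive, so that the
terms involving a newly inserted first argument can be isolated. -/
theorem sum_castSucc_lt_succ {m : ℕ} (G : Fin (m + 2) → Fin (m + 1) → T) :
    ∑ j : Fin (m + 2), ∑ i : Fin (m + 1) with i.castSucc < j, G j i =
      ∑ j : Fin (m + 1), G j.succ 0 +
        ∑ j : Fin (m + 1), ∑ i : Fin m with i.castSucc < j, G j.succ i.succ := by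
  rw [Fin.sum_univ_succ, ← Finset.sum_add_distrib, Finset.sum_eq_zero (by simp), zero_add]
  refine Finset.sum_congr rfl fun j _ => ?_
  rw [Finset.sum_filter, Fin.sum_univ_succ, Finset.sum_filter]
  congr 1
  simp only [← Fin.succ_castSucc, Fin.succ_lt_succ_iff]

/-- Pairs that contain the inserted `x` give the bracket part of the Lie derivative along `x`. In
the other pairs `x` stands just behind the bracket, and moving it to the front costs the sign of the
last term. -/
theorem IsSkew.contract_bracketD {m : ℕ} {F : (Fin (m + 1) → X) → T} (hF : IsSkew F) (x : X)
    (q : Fin (m + 1) → X) :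
    bracketD br F (Fin.cons x q) =
      - ∑ k, F (Function.update q k (br x (q k))) - bracketD br (LieConformal.contract x F) q := by
  rw [bracketD]
  beta_reduce
  rw [sum_castSucc_lt_succ, sub_eq_add_neg, ← Finset.sum_neg_distrib]
  congr 1
  · refine Finset.sum_congr rfl fun j _ => ?_
    have h := hF.cons_removeNth q j (br x (q j))
    have e : (fun k => (Fin.cons x q : Fin (m + 2) → X) (j.succ.succAbove (Fin.succAbove 0 k))) =
        fun k => q (j.succAbove k) := by
      ext k; simp
    rw [e]
    simp only [Fin.succ_succAbove_zero, Fin.cons_zero, Fin.cons_succ, h, smul_smul, Fin.val_zero,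
      Fin.val_succ, zero_add]
    -- The sign `(-1)^(j+1)` of the pair `(0, j+1)` times the sign `(-1)^j` of moving the bracket to
    -- slot `j` is `-1`.
    rw [pow_succ, mul_right_comm, ← mul_pow]
    simp
  · cases m with
    | zero => simp [bracketD]
    | succ m =>
      simp only [bracketD, ← Finset.sum_neg_distrib]
      refine Finset.sum_congr rfl fun j _ => Finset.sum_congr rfl fun i _ => ?_
      have e : (fun k => (Fin.cons x q : Fin (m + 3) → X) (j.succ.succAbove (i.succ.succAbove k))) =
          Fin.cons x fun k => q (j.succAbove (i.succAbove k)) := by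
        ext k
        refine Fin.cases ?_ (fun k => ?_) k <;> simp
      rw [e, hF.cons_cons]
      simp only [Fin.succ_succAbove_succ, Fin.cons_succ, LieConformal.contract, Fin.val_succ,
        smul_neg]
      congr 2
      ring

/-- The explicit formula satisfies the recursion that defines `leibnizD`: the `i = 0` action term
and the pairs containing index `0` form `L_x F`, and all other terms form `-d(i_x F)`, their signs
being shifted by one index. -/
theorem IsSkew.chevalleyD_eq {n : ℕ} {F : (Fin n → X) → T} (hF : IsSkew F) :
    chevalleyD br act F = leibnizD br act F := by
  induction n with
  | zero =>
    refine eq_of_contract_eq fun x => ?_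
    funext q
    simp [leibnizD, LieConformal.contract, chevalleyD, bracketD, lieDer]
  | succ m ih =>
    refine eq_of_contract_eq fun x => ?_
    rw [contract_leibnizD, ← ih (hF.contract x)]
    funext q
    rw [LieConformal.contract, chevalleyD, hF.contract_bracketD, Fin.sum_univ_succ]
    simp only [Pi.sub_apply, lieDer, chevalleyD, cons_succ_succAbove, Fin.cons_succ, Fin.val_succ,
      pow_succ, mul_neg, mul_one, neg_smul, Finset.sum_neg_distrib, LieConformal.contract]
    simp
    abel

end ChevalleyEilenberg

/-! ### Extension of scalars for multilinear maps -/

section MultilinearBaseChange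
variable {R L W : Type*} [CommRing R] [Algebra ℂ R] [AddCommGroup L] [Module ℂ L]
  [AddCommGroup W] [Module R W]

/-- The elements `1 ⊗ p` generate `R ⊗ L` over `R`. This reduces identities between evaluated
cochains to arguments from `L`. -/
theorem multilinear_baseChange_ext {n : ℕ} {g h : MultilinearMap R (fun _ : Fin n => R ⊗[ℂ] L) W}
    (H : ∀ p : Fin n → L, g (fun i => 1 ⊗ₜ p i) = h (fun i => 1 ⊗ₜ p i)) : g = h := by
  induction n with
  | zero => ext u; simpa [Subsingleton.elim u (fun i => 1 ⊗ₜ (0 : L))] using H 0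
  | succ n ih =>
    have key : g.curryLeft = h.curryLeft := by
      ext1 u
      induction u with
      | zero => simp
      | add u v hu hv => rw [map_add, map_add, hu, hv]
      | tmul r c =>
        have : r ⊗ₜ[ℂ] c = r • (1 ⊗ₜ[ℂ] c) := by simp [TensorProduct.smul_tmul']
        rw [this, map_smul, map_smul]
        congr 1
        refine ih fun p => ?_
        have e : (Fin.cons (1 ⊗ₜ c) (fun i => 1 ⊗ₜ p i) : Fin (n + 1) → R ⊗[ℂ] L) =
            fun i => 1 ⊗ₜ (Fin.cons c p : Fin (n + 1) → L) i := by
          ext i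
          refine Fin.cases ?_ (fun i => ?_) i <;> simp
        rw [MultilinearMap.curryLeft_apply, MultilinearMap.curryLeft_apply, e, H]
    rw [← MultilinearMap.uncurry_curryLeft g, key, MultilinearMap.uncurry_curryLeft]

variable [Module ℂ W] [IsScalarTower ℂ R W]

instance (n : ℕ) : IsScalarTower ℂ R (MultilinearMap R (fun _ : Fin n => R ⊗[ℂ] L) W) :=
  ⟨fun c r f => by ext; simp⟩

/-- The `R`-multilinear extension of a `ℂ`-multilinear map with values in an `R`-module. -/
noncomputable def liftMultilinear : (n : ℕ) →
    MultilinearMap ℂ (fun _ : Fin n => L) W →ₗ[ℂ] MultilinearMap R (fun _ : Fin n => R ⊗[ℂ] L) W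
  | 0 =>
    { toFun := fun f => MultilinearMap.constOfIsEmpty R _ (f 0)
      map_add' := fun f g => by ext; simp
      map_smul' := fun c f => by ext; simp }
  | n + 1 =>
    { toFun := fun f => LinearMap.uncurryLeft (M := fun _ => R ⊗[ℂ] L)
        (LinearMap.liftBaseChange R (liftMultilinear n ∘ₗ f.curryLeft))
      map_add' := fun f g => multilinear_baseChange_ext fun p => by
        have h : (f + g).curryLeft (p 0) = f.curryLeft (p 0) + g.curryLeft (p 0) := rfl
        simp [h]
      map_smul' := fun c f => multilinear_baseChange_ext fun p => by
        have h : (c • f).curryLeft (p 0) = c • f.curryLeft (p 0) := rfl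
        simp [h] }

theorem liftMultilinear_one_tmul {n : ℕ} (f : MultilinearMap ℂ (fun _ : Fin n => L) W)
    (p : Fin n → L) : liftMultilinear (R := R) n f (fun i => 1 ⊗ₜ p i) = f p := by
  induction n with
  | zero => simp [liftMultilinear, Subsingleton.elim p 0]
  | succ n ih =>
    have : (Fin.tail fun i => (1 : R) ⊗ₜ[ℂ] p i) = fun i => 1 ⊗ₜ Fin.tail p i := rfl
    simp [liftMultilinear, this, ih]

end MultilinearBaseChange

/-! ### Homogeneous elements and the graded module in which `∂` acts by minus the degree -/

section Graded
variable (R L : Type*) [CommRing R] [Algebra ℂ R] [AddCommGroup L] [Module ℂ L] [Module ℂ[X] L]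
  [IsScalarTower ℂ ℂ[X] L]

variable {R L} in
theorem LieConformalAlgebra.extend_jacobi (A : LieConformalAlgebra L) (a b : R)
    (u v w : R ⊗[ℂ] L) :
    extend A.bracket a u (extend A.bracket b v w) =
      extend A.bracket (a + b) (extend A.bracket a u v) w +
      extend A.bracket b v (extend A.bracket a u w) := by
  have one (r : R) (p : L) : r ⊗ₜ[ℂ] p = r • (1 ⊗ₜ[ℂ] p) := by
    simp [TensorProduct.smul_tmul']
  induction u with
  | zero => simp
  | add x y hx hy => simp only [map_add, LinearMap.add_apply, hx, hy]; abel
  | tmul r p =>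
    induction v with
    | zero => simp
    | add x y hx hy => simp only [map_add, LinearMap.add_apply, hx, hy]; abel
    | tmul s q =>
      induction w with
      | zero => simp
      | add x y hx hy => simp only [map_add, hx, hy]; abel
      | tmul t w =>
        -- The Jacobi identity holds in the polynomial variables `λ, μ`, hence for any values `λ ↦
        -- a`, `μ ↦ b` in `R`.
        have h := congrArg (mapCoeff (MvPolynomial.aeval ![a, b])) (A.jacobi p q w)
        simp only [map_add, mapCoeff_extend, mapCoeff_tmul, map_one, MvPolynomial.aeval_X,
          Matrix.cons_val_zero, Matrix.cons_val_one] at h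
        rw [one r, one s, one t]
        simp only [map_smul, LinearMap.smul_apply, h, smul_add, smul_smul]
        congr 2 <;> ring

/-- The operator `∂ + c` on `R ⊗ L`. -/
noncomputable def gradedTotal (c : R) : R ⊗[ℂ] L →ₗ[R] R ⊗[ℂ] L :=
  (del L).baseChange R + c • LinearMap.id

/-- The quotient of `R ⊗ L` in which `∂` acts as `-c`. -/
def GradedPiece (c : R) : Type _ := (R ⊗[ℂ] L) ⧸ LinearMap.range (gradedTotal R L c)

noncomputable instance (c : R) : AddCommGroup (GradedPiece R L c) :=
  inferInstanceAs (AddCommGroup ((R ⊗[ℂ] L) ⧸ LinearMap.range (gradedTotal R L c)))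

noncomputable instance (c : R) : Module R (GradedPiece R L c) :=
  inferInstanceAs (Module R ((R ⊗[ℂ] L) ⧸ LinearMap.range (gradedTotal R L c)))

/-- The `R`-graded module with component `R ⊗ L / (∂ + c)` in degree `c`. -/
def Graded : Type _ := DirectSum R (GradedPiece R L)

noncomputable instance : AddCommGroup (Graded R L) :=
  inferInstanceAs (AddCommGroup (DirectSum R (GradedPiece R L)))

noncomputable instance : Module R (Graded R L) :=
  inferInstanceAs (Module R (DirectSum R (GradedPiece R L)))

noncomputable instance : Module ℂ (Graded R L) := Module.compHom _ (algebraMap ℂ R)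

instance : IsScalarTower ℂ R (Graded R L) :=
  ⟨fun c r u => by rw [Algebra.smul_def, mul_smul]; rfl⟩

variable {R L} [DecidableEq R]

/-- The class of an element in degree `c`. -/
noncomputable def gradedMk (c : R) : R ⊗[ℂ] L →ₗ[R] Graded R L :=
  (show GradedPiece R L c →ₗ[R] Graded R L from DirectSum.lof R R (GradedPiece R L) c) ∘ₗ
    (show R ⊗[ℂ] L →ₗ[R] GradedPiece R L c from (LinearMap.range (gradedTotal R L c)).mkQ)

theorem gradedMk_total (c : R) (u : R ⊗[ℂ] L) :
    gradedMk c ((del L).baseChange R u + c • u) = 0 := by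
  have : (show R ⊗[ℂ] L →ₗ[R] GradedPiece R L c from (LinearMap.range (gradedTotal R L c)).mkQ)
      ((del L).baseChange R u + c • u) = 0 :=
    (Submodule.Quotient.mk_eq_zero _).2 ⟨u, rfl⟩
  rw [gradedMk, LinearMap.comp_apply, this, map_zero]

section Lift
variable {W : Type*} [AddCommGroup W] [Module R W]

/-- Maps out of `Graded R L`. -/
noncomputable def gradedLift (φ : R → R ⊗[ℂ] L →ₗ[R] W)
    (h : ∀ c u, φ c ((del L).baseChange R u + c • u) = 0) : Graded R L →ₗ[R] W :=
  show DirectSum R (GradedPiece R L) →ₗ[R] W from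
  DirectSum.toModule R R W fun c =>
    show ((R ⊗[ℂ] L) ⧸ LinearMap.range (gradedTotal R L c)) →ₗ[R] W from
    Submodule.liftQ (LinearMap.range (gradedTotal R L c)) (φ c)
      (by rintro _ ⟨u, rfl⟩; exact h c u)

theorem gradedLift_mk (φ : R → R ⊗[ℂ] L →ₗ[R] W)
    (h : ∀ c u, φ c ((del L).baseChange R u + c • u) = 0) (c : R) (u : R ⊗[ℂ] L) :
    gradedLift φ h (gradedMk c u) = φ c u :=
  DirectSum.toModule_lof (M := GradedPiece R L) R c _

theorem graded_ext {g h : Graded R L →ₗ[R] W}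
    (H : ∀ c u, g (gradedMk c u) = h (gradedMk c u)) : g = h :=
  DirectSum.linearMap_ext (M := GradedPiece R L) R fun c => LinearMap.ext fun v => by
    obtain ⟨u, rfl⟩ := Submodule.mkQ_surjective (LinearMap.range (gradedTotal R L c)) v
    exact H c u

end Lift

/-- The action of an element `u` of degree `a`. -/
noncomputable def SesquilinearBracket.gradedAct (B : SesquilinearBracket L) (a : R) :
    R ⊗[ℂ] L →ₗ[R] Graded R L →ₗ[R] Graded R L where
  -- Well defined because sesquilinearity gives `[u_a (∂ + c)v] = (∂ + a + c)[u_a v]`, which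
  -- vanishes in degree `a + c`.
  toFun u := gradedLift (fun c => gradedMk (a + c) ∘ₗ extend B.bracket a u) fun c v => by
    rw [LinearMap.comp_apply, map_add, map_smul, B.extend_del_right,
      ← gradedMk_total (a + c) (extend B.bracket a u v), add_smul, add_assoc]
  map_add' u v := graded_ext fun c w => by simp [gradedLift_mk]
  map_smul' r u := graded_ext fun c w => by simp [gradedLift_mk]

theorem SesquilinearBracket.gradedAct_mk (B : SesquilinearBracket L) (a c : R) (u v : R ⊗[ℂ] L) :
    B.gradedAct a u (gradedMk c v) = gradedMk (a + c) (extend B.bracket a u v) := by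
  simp [gradedAct, gradedLift_mk]

/-- The bracket of homogeneous elements of `⨁_a R ⊗ L`, given with their degrees. -/
noncomputable def SesquilinearBracket.gradedBr (B : SesquilinearBracket L)
    (x y : R × (R ⊗[ℂ] L)) : R × (R ⊗[ℂ] L) :=
  (x.1 + y.1, extend B.bracket x.1 x.2 y.2)

/-- The action of homogeneous elements on `Graded R L`. -/
noncomputable def SesquilinearBracket.homogAct (B : SesquilinearBracket L)
    (x : R × (R ⊗[ℂ] L)) : Graded R L →+ Graded R L :=
  (B.gradedAct x.1 x.2).toAddMonoidHom

/-- The module axiom `hact` of the Cartan calculus. It is the Jacobi identity with values in `R`,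
all three terms lying in the same degree since addition in `R` is commutative. -/
theorem LieConformalAlgebra.homogAct_homogAct (A : LieConformalAlgebra L)
    (x y : R × (R ⊗[ℂ] L)) (t : Graded R L) :
    A.homogAct x (A.homogAct y t) =
      A.homogAct (A.gradedBr x y) t + A.homogAct y (A.homogAct x t) := by
  have : A.gradedAct x.1 x.2 ∘ₗ A.gradedAct y.1 y.2 =
      A.gradedAct (x.1 + y.1) (extend A.bracket x.1 x.2 y.2) +
        A.gradedAct y.1 y.2 ∘ₗ A.gradedAct x.1 x.2 := graded_ext fun c u => by
    simp only [LinearMap.comp_apply, LinearMap.add_apply, SesquilinearBracket.gradedAct_mk]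
    rw [A.extend_jacobi, map_add, add_assoc, add_left_comm y.1 x.1 c]
  exact LinearMap.congr_fun this t

/-- The substitution of `a` for the variables `λ`. -/
noncomputable def valuesEval {n : ℕ} (a : Fin n → R) : Values L n →ₗ[ℂ] Graded R L :=
  Values.lift ((gradedMk (∑ k, a k)).restrictScalars ℂ ∘ₗ mapCoeff (MvPolynomial.aeval a))
    (fun u => by
      rw [total_apply, LinearMap.comp_apply, map_add, mapCoeff_baseChange, mapCoeff_smul,
        LinearMap.restrictScalars_apply, map_sum]
      simp only [MvPolynomial.aeval_X]
      exact gradedMk_total _ _)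

theorem valuesEval_mk {n : ℕ} (a : Fin n → R) (u : LPoly L n) :
    valuesEval a (Values.mk n u) = gradedMk (∑ k, a k) (mapCoeff (MvPolynomial.aeval a) u) := rfl

theorem valuesEval_smul {n : ℕ} (a : Fin n → R) (P : MvPolynomial (Fin n) ℂ) (v : Values L n) :
    valuesEval a (P • v) = MvPolynomial.aeval a P • valuesEval a v := by
  obtain ⟨u, rfl⟩ := Values.mk_surjective n v
  rw [← map_smul, valuesEval_mk, valuesEval_mk, mapCoeff_smul, map_smul]

theorem valuesEval_subst {m n : ℕ} (a : Fin n → R)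
    (e : MvPolynomial (Fin m) ℂ →ₐ[ℂ] MvPolynomial (Fin n) ℂ)
    (he : e (∑ k, MvPolynomial.X k) = ∑ k, MvPolynomial.X k) (v : Values L m) :
    valuesEval a (Values.subst e he v) =
      valuesEval (fun k => MvPolynomial.aeval a (e (MvPolynomial.X k))) v := by
  obtain ⟨u, rfl⟩ := Values.mk_surjective m v
  have h1 : ∑ k, MvPolynomial.aeval a (e (MvPolynomial.X k)) = ∑ k, a k := by
    rw [← map_sum, ← map_sum, he]
    simp
  have h2 : (MvPolynomial.aeval a).comp e =
      MvPolynomial.aeval fun k => MvPolynomial.aeval a (e (MvPolynomial.X k)) := by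
    ext k; simp
  rw [Values.subst_mk, valuesEval_mk, valuesEval_mk, mapCoeff_mapCoeff, h1, h2]

theorem valuesEval_perm {n : ℕ} (a : Fin n → R) (σ : Equiv.Perm (Fin n)) (v : Values L n) :
    valuesEval a (Values.perm σ v) = valuesEval (a ∘ σ) v := by
  rw [Values.perm, valuesEval_subst]
  simp [Function.comp_def]

theorem valuesEval_act (B : SesquilinearBracket L) {n : ℕ} (a : Fin (n + 1) → R)
    (i : Fin (n + 1)) (p : L) (v : Values L n) :
    valuesEval a (B.act i p v) =
      B.gradedAct (a i) (1 ⊗ₜ p) (valuesEval (fun k => a (i.succAbove k)) v) := by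
  obtain ⟨u, rfl⟩ := Values.mk_surjective n v
  have h : (MvPolynomial.aeval a).comp (MvPolynomial.rename i.succAbove) =
      MvPolynomial.aeval (R := ℂ) fun k => a (i.succAbove k) := by
    ext k; simp
  rw [B.act_mk, valuesEval_mk, valuesEval_mk, B.gradedAct_mk, Fin.sum_univ_succAbove _ i,
    mapCoeff_extend, mapCoeff_mapCoeff, h]
  simp

/-- Substituting the variables for themselves embeds the values as the component of degree `∑ λ_k`,
where the relation `∂ + ∑ λ_k = 0` is exactly the one that defines `Values`. -/
theorem valuesEval_X_injective (n : ℕ) [DecidableEq (MvPolynomial (Fin n) ℂ)] : Function.Injective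
    (valuesEval (L := L) (MvPolynomial.X : Fin n → MvPolynomial (Fin n) ℂ)) := by
  -- The projection to that component is a left inverse.
  let s : Graded (MvPolynomial (Fin n) ℂ) L →ₗ[MvPolynomial (Fin n) ℂ] Values L n :=
    gradedLift (fun c => if c = ∑ k, MvPolynomial.X k then Values.mk n else 0) fun c u => by
      split_ifs with h
      · subst h
        exact Values.mk_total n u
      · rfl
  have hs : ∀ u, s (gradedMk (∑ k, MvPolynomial.X k) u) = Values.mk n u := fun u => by
    simp [s, gradedLift_mk]
  refine Function.LeftInverse.injective (g := s) fun v => ?_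
  obtain ⟨u, rfl⟩ := Values.mk_surjective n v
  rw [valuesEval_mk, hs, MvPolynomial.aeval_X_left]
  congr 1
  exact LinearMap.rTensor_id_apply _ _ u

end Graded

/-! ### Conformal cochains as functions of homogeneous elements -/

section Evaluation
variable {R L : Type*} [CommRing R] [Algebra ℂ R] [AddCommGroup L] [Module ℂ L] [Module ℂ[X] L]
  [IsScalarTower ℂ ℂ[X] L] [DecidableEq R]

/-- The `R`-multilinear extension of a cochain, with `a` substituted for the variables `λ`. -/
noncomputable def evalAt {n : ℕ} (a : Fin n → R)
    (f : MultilinearMap ℂ (fun _ : Fin n => L) (Values L n)) :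
    MultilinearMap R (fun _ : Fin n => R ⊗[ℂ] L) (Graded R L) :=
  liftMultilinear n ((valuesEval a).compMultilinearMap f)

theorem evalAt_one_tmul {n : ℕ} (a : Fin n → R)
    (f : MultilinearMap ℂ (fun _ : Fin n => L) (Values L n)) (p : Fin n → L) :
    evalAt a f (fun i => 1 ⊗ₜ p i) = valuesEval a (f p) :=
  liftMultilinear_one_tmul _ _

/-- A cochain as a function of homogeneous elements of `⨁_a R ⊗ L`, given with their degrees. -/
noncomputable def evalCochain {n : ℕ} (f : MultilinearMap ℂ (fun _ : Fin n => L) (Values L n))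
    (x : Fin n → R × (R ⊗[ℂ] L)) : Graded R L :=
  evalAt (fun i => (x i).1) f (fun i => (x i).2)

/-- The generic arguments `(λ_i, 1 ⊗ p_i)` already recover `f(p)`. -/
theorem evalCochain_injective {n : ℕ} [DecidableEq (MvPolynomial (Fin n) ℂ)]
    {f g : MultilinearMap ℂ (fun _ : Fin n => L) (Values L n)}
    (h : evalCochain (R := MvPolynomial (Fin n) ℂ) f = evalCochain g) : f = g := by
  ext p
  refine valuesEval_X_injective n ?_
  have := congrFun h fun i => (MvPolynomial.X i, 1 ⊗ₜ p i)
  rwa [evalCochain, evalCochain, evalAt_one_tmul, evalAt_one_tmul] at this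

theorem evalAt_comp_perm {n : ℕ} (a : Fin n → R) (σ : Equiv.Perm (Fin n))
    {f : MultilinearMap ℂ (fun _ : Fin n => L) (Values L n)} (hf : f ∈ Cochain L n)
    (u : Fin n → R ⊗[ℂ] L) :
    evalAt (a ∘ σ) f (u ∘ σ) = (Equiv.Perm.sign σ : ℤ) • evalAt a f u := by
  have h : (evalAt (a ∘ σ) f).domDomCongr σ = (Equiv.Perm.sign σ : ℤ) • evalAt a f :=
    multilinear_baseChange_ext fun p => by
      rw [MultilinearMap.domDomCongr_apply, smul_apply, evalAt_one_tmul,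
        evalAt_one_tmul, ← valuesEval_perm, ← map_zsmul]
      exact congrArg _ (hf.2 σ p)
  exact congrArg (fun g => g u) h

/-- Conformal skew-symmetry permutes the `p_k` and the `λ_k` together. Since each homogeneous
argument carries its own `λ`, it becomes ordinary skew-symmetry. -/
theorem isSkew_evalCochain {n : ℕ}
    {f : MultilinearMap ℂ (fun _ : Fin n => L) (Values L n)} (hf : f ∈ Cochain L n) :
    IsSkew (evalCochain (R := R) f) := fun σ x =>
  evalAt_comp_perm (fun i => (x i).1) σ hf (fun i => (x i).2)

theorem evalCochain_update {n : ℕ} (f : MultilinearMap ℂ (fun _ : Fin n => L) (Values L n))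
    (x : Fin n → R × (R ⊗[ℂ] L)) (k : Fin n) (s : R) (u : R ⊗[ℂ] L) :
    evalCochain f (Function.update x k (s, u)) =
      evalAt (Function.update (fun i => (x i).1) k s) f
        (Function.update (fun i => (x i).2) k u) := by
  rw [evalCochain]
  congr 1
  · congr 1
    ext i
    rcases eq_or_ne i k with rfl | h <;> simp [*]
  · ext i
    rcases eq_or_ne i k with rfl | h <;> simp [*]

/-- The three iterated brackets have the same degree, so they differ only in the `R ⊗ L` component
of slot `k`, where the evaluated cochain is additive. -/
theorem LieConformalAlgebra.respectsJacobi_evalCochain (A : LieConformalAlgebra L) {n : ℕ}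
    (f : MultilinearMap ℂ (fun _ : Fin n => L) (Values L n)) :
    RespectsJacobi A.gradedBr (evalCochain (R := R) f) := fun p k x y z => by
  simp only [SesquilinearBracket.gradedBr, evalCochain_update]
  rw [A.extend_jacobi, MultilinearMap.map_update_add, add_assoc, add_left_comm y.1]

theorem SesquilinearBracket.evalAt_actTerm (B : SesquilinearBracket L) {n : ℕ} (i : Fin (n + 1))
    (a : Fin (n + 1) → R) (f : MultilinearMap ℂ (fun _ : Fin n => L) (Values L n))
    (u : Fin (n + 1) → R ⊗[ℂ] L) :
    evalAt a (B.actTerm i f) u =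
      B.gradedAct (a i) (u i) (evalAt (fun k => a (i.succAbove k)) f fun k => u (i.succAbove k)) := by
  -- The right-hand side is packaged as an `R`-multilinear map of `u`, so that comparison on the
  -- elements `1 ⊗ p` suffices.
  have h : evalAt a (B.actTerm i f) = LinearMap.uncurryMid (M := fun _ => R ⊗[ℂ] L) i
      { toFun := fun y => (B.gradedAct (a i) y).compMultilinearMap
          (evalAt (fun k => a (i.succAbove k)) f)
        map_add' := fun x y => by ext p; simp
        map_smul' := fun c x => by ext p; simp } :=
    multilinear_baseChange_ext fun p => by
      rw [evalAt_one_tmul, B.actTerm_apply, valuesEval_act, ← evalAt_one_tmul]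
      rfl
  rw [h]
  rfl

/-- After evaluation, the sum over the coefficients of `z` is absorbed by `R`-linearity in the first
slot, and the merged variable becomes the degree `a_{i'} + a_j` of that slot. -/
theorem valuesEval_insertFirst {m : ℕ} (j : Fin (m + 2)) (i : Fin (m + 1))
    (a : Fin (m + 2) → R) (b : MvPolynomial (Fin (m + 2)) ℂ)
    (f : MultilinearMap ℂ (fun _ : Fin (m + 1) => L) (Values L (m + 1)))
    (z : ℂ[X] ⊗[ℂ] L) (p : Fin m → L) :
    valuesEval a (insertFirst j i b f z p) =
      evalAt (Fin.cons (a (j.succAbove i) + a j) fun k => a (j.succAbove (i.succAbove k))) f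
        (Fin.cons (mapCoeff (Polynomial.aeval (MvPolynomial.aeval a b)) z) fun k => 1 ⊗ₜ p k) := by
  induction z with
  | zero =>
    rw [map_zero, map_zero, zero_apply, map_zero]
    exact (MultilinearMap.map_coord_zero _ 0 rfl).symm
  | add x y hx hy =>
    rw [map_add, map_add, add_apply, map_add, hx, hy, ← MultilinearMap.cons_add]
  | tmul P c =>
    have e : (fun k => MvPolynomial.aeval a (mergeVars j i (MvPolynomial.X k))) =
        (Fin.cons (a (j.succAbove i) + a j) fun k => a (j.succAbove (i.succAbove k)) :
          Fin (m + 1) → R) := by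
      ext k
      refine Fin.cases ?_ (fun k => ?_) k <;> simp [mergeVars]
    have e' : (Fin.cons (1 ⊗ₜ c) fun k => 1 ⊗ₜ p k : Fin (m + 1) → R ⊗[ℂ] L) =
        fun k => 1 ⊗ₜ (Fin.cons c p : Fin (m + 1) → L) k := by
      ext k
      refine Fin.cases ?_ (fun k => ?_) k <;> simp
    have e'' (r : R) : r ⊗ₜ[ℂ] c = r • (1 ⊗ₜ[ℂ] c) := by simp [TensorProduct.smul_tmul']
    rw [insertFirst_tmul, valuesEval_smul, valuesEval_subst, e, mapCoeff_tmul, e'',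
      MultilinearMap.cons_smul, e', evalAt_one_tmul, Polynomial.aeval_algHom_apply]

theorem SesquilinearBracket.evalAt_bracketTerm (B : SesquilinearBracket L) {m : ℕ}
    (j : Fin (m + 2)) (i : Fin (m + 1)) (a : Fin (m + 2) → R)
    (f : MultilinearMap ℂ (fun _ : Fin (m + 1) => L) (Values L (m + 1)))
    (u : Fin (m + 2) → R ⊗[ℂ] L) :
    evalAt a (B.bracketTerm j i f) u =
      evalAt (Fin.cons (a (j.succAbove i) + a j) fun k => a (j.succAbove (i.succAbove k))) f
        (Fin.cons (extend B.bracket (a (j.succAbove i)) (u (j.succAbove i)) (u j))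
          fun k => u (j.succAbove (i.succAbove k))) := by
  set g := evalAt (Fin.cons (a (j.succAbove i) + a j) fun k => a (j.succAbove (i.succAbove k))) f
  have h : evalAt a (B.bracketTerm j i f) = LinearMap.uncurryMid (M := fun _ => R ⊗[ℂ] L) j
      { toFun := fun y => LinearMap.uncurryMid (M := fun _ => R ⊗[ℂ] L) i
          (g.curryLeft ∘ₗ (extend B.bracket (a (j.succAbove i))).flip y)
        map_add' := fun x y => by ext p; simp
        map_smul' := fun c x => by ext p; simp } :=
    multilinear_baseChange_ext fun p => by
      rw [evalAt_one_tmul, B.bracketTerm_apply, valuesEval_insertFirst, MvPolynomial.aeval_X]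
      have e : extend B.bracket (a (j.succAbove i)) (1 ⊗ₜ p (j.succAbove i)) (1 ⊗ₜ p j) =
          mapCoeff (Polynomial.aeval (a (j.succAbove i)))
            (B.bracket (p (j.succAbove i)) (p j)) := by
        rw [extend_tmul, mul_one, one_smul]
      rw [← e]
      rfl
  rw [h]
  rfl

/-- Evaluation at fixed degrees is additive in the cochain. -/
noncomputable def evalAtHom {n : ℕ} (x : Fin n → R × (R ⊗[ℂ] L)) :
    MultilinearMap ℂ (fun _ : Fin n => L) (Values L n) →+ Graded R L where
  toFun f := evalCochain f x
  map_zero' := by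
    have : evalAt (fun i => (x i).1) (0 : MultilinearMap ℂ (fun _ : Fin n => L) (Values L n)) = 0 :=
      multilinear_baseChange_ext fun p => by rw [evalAt_one_tmul]; simp
    rw [evalCochain, this, zero_apply]
  map_add' f g := by
    have : evalAt (fun i => (x i).1) (f + g) =
        evalAt (fun i => (x i).1) f + evalAt (fun i => (x i).1) g :=
      multilinear_baseChange_ext fun p => by
        rw [evalAt_one_tmul, add_apply, add_apply, map_add, evalAt_one_tmul, evalAt_one_tmul]
    rw [evalCochain, this, add_apply, evalCochain, evalCochain]

theorem SesquilinearBracket.evalCochain_bracketSum (B : SesquilinearBracket L) {n : ℕ}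
    (f : MultilinearMap ℂ (fun _ : Fin n => L) (Values L n)) :
    evalCochain (R := R) (B.bracketSum f) = bracketD B.gradedBr (evalCochain f) := by
  funext x
  change evalAtHom x (B.bracketSum f) = _
  cases n with
  | zero => exact map_zero _
  | succ m =>
    simp only [bracketSum, bracketD, map_sum, map_zsmul]
    refine Finset.sum_congr rfl fun j _ => Finset.sum_congr rfl fun i _ => ?_
    congr 1
    refine (B.evalAt_bracketTerm j i (fun k => (x k).1) f fun k => (x k).2).trans ?_
    rw [evalCochain]
    congr 1
    · congr 1
      ext k
      refine Fin.cases ?_ (fun k => ?_) k <;> simp [gradedBr]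
    · ext k
      refine Fin.cases ?_ (fun k => ?_) k <;> simp [gradedBr]

/-- The conformal formula turns into the classical one because the variable `λ_i + λ_j` attached to
`[p_i, p_j]` is the degree of the bracket of homogeneous elements. -/
theorem SesquilinearBracket.evalCochain_actSum_add_bracketSum (B : SesquilinearBracket L) {n : ℕ}
    (f : MultilinearMap ℂ (fun _ : Fin n => L) (Values L n)) :
    evalCochain (R := R) (B.actSum f + B.bracketSum f) =
      chevalleyD B.gradedBr B.homogAct (evalCochain f) := by
  funext x
  rw [chevalleyD, ← B.evalCochain_bracketSum]
  change evalAtHom x (B.actSum f + B.bracketSum f) = _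
  rw [map_add]
  congr 1
  rw [actSum, map_sum]
  refine Finset.sum_congr rfl fun i _ => ?_
  rw [map_zsmul]
  congr 1
  exact B.evalAt_actTerm i (fun k => (x k).1) f fun k => (x k).2

end Evaluation

/-! ### The coboundary operator squares to zero -/

section CoboundarySquare
variable {L : Type*} [AddCommGroup L] [Module ℂ L] [Module ℂ[X] L] [IsScalarTower ℂ ℂ[X] L]

theorem LieConformalAlgebra.evalCochain_coboundary {R : Type*} [CommRing R] [Algebra ℂ R]
    [DecidableEq R] (A : LieConformalAlgebra L) {n : ℕ} (f : Cochain L n) :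
    evalCochain (R := R) (A.coboundary n f).1 = leibnizD A.gradedBr A.homogAct (evalCochain f.1) := by
  rw [← (isSkew_evalCochain f.2).chevalleyD_eq]
  exact A.evalCochain_actSum_add_bracketSum f.1

theorem LieConformalAlgebra.coboundary_coboundary (A : LieConformalAlgebra L) {n : ℕ}
    (f : Cochain L n) : A.coboundary (n + 1) (A.coboundary n f) = 0 := by
  -- `δ²f` has `n + 2` arguments, so polynomials in `n + 2` variables are the coefficients over
  -- which evaluation is faithful. As degrees they index a direct sum, which needs decidable
  -- equality.
  let _ : DecidableEq (MvPolynomial (Fin (n + 2)) ℂ) := Classical.decEq _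
  refine Subtype.ext (evalCochain_injective ?_)
  rw [A.evalCochain_coboundary, A.evalCochain_coboundary,
    leibnizD_leibnizD A.homogAct_homogAct (A.respectsJacobi_evalCochain f.1)]
  funext x
  exact (map_zero (evalAtHom x)).symm

end CoboundarySquare

/-! ### Commutation relations between `δ`, `δ_N`, `d_N` and the operator `N` -/

section NijenhuisComplex
variable {L : Type*} [AddCommGroup L] [Module ℂ L] [Module ℂ[X] L] [IsScalarTower ℂ ℂ[X] L]

theorem SesquilinearBracket.act_compLeft (B : SesquilinearBracket L) (N : L →ₗ[ℂ[X]] L) {n : ℕ}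
    (i : Fin (n + 1)) (p : L) (v : Values L n) : (B.compLeft N).act i p v = B.act i (N p) v := by
  obtain ⟨u, rfl⟩ := Values.mk_surjective n v
  have h : ∀ w, extend (B.compLeft N).bracket (MvPolynomial.X i : MvPolynomial (Fin (n + 1)) ℂ)
      (1 ⊗ₜ p) w = extend B.bracket (MvPolynomial.X i) (1 ⊗ₜ N p) w := fun w => by
    induction w with
    | zero => simp
    | add x y hx hy => rw [map_add, map_add, hx, hy]
    | tmul r q => simp [compLeft]
  rw [B.act_mk, act_mk, h]

theorem SesquilinearBracket.act_deform (B : SesquilinearBracket L) (N : L →ₗ[ℂ[X]] L) {n : ℕ}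
    (i : Fin (n + 1)) (p : L) (v : Values L n) :
    (B.deform N).act i p v = (B.compLeft N).act i p v + B.act i p (Values.map N n v) -
      Values.map N (n + 1) (B.act i p v) := by
  rw [B.act_compLeft]
  obtain ⟨u, rfl⟩ := Values.mk_surjective n v
  rw [Values.map_mk, B.act_mk, B.act_mk, B.act_mk, (B.deform N).act_mk, Values.map_mk,
    B.extend_deform, LinearMap.map_sub, LinearMap.map_add, mapCoeff_baseChange,
    LinearMap.baseChange_tmul, LinearMap.restrictScalars_apply]

theorem Values.map_subst (N : L →ₗ[ℂ[X]] L) {m n : ℕ}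
    (e : MvPolynomial (Fin m) ℂ →ₐ[ℂ] MvPolynomial (Fin n) ℂ)
    (he : e (∑ k, MvPolynomial.X k) = ∑ k, MvPolynomial.X k) (v : Values L m) :
    Values.map N n (Values.subst e he v) = Values.subst e he (Values.map N m v) := by
  obtain ⟨u, rfl⟩ := Values.mk_surjective m v
  rw [Values.map_mk, Values.subst_mk, Values.map_mk, Values.subst_mk, mapCoeff_baseChange]

theorem insertFirst_compMultilinearMap_map (N : L →ₗ[ℂ[X]] L) {m : ℕ} (j : Fin (m + 2))
    (i : Fin (m + 1)) (a : MvPolynomial (Fin (m + 2)) ℂ)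
    (f : MultilinearMap ℂ (fun _ : Fin (m + 1) => L) (Values L (m + 1)))
    (z : ℂ[X] ⊗[ℂ] L) (p : Fin m → L) :
    insertFirst j i a ((Values.map N (m + 1)).compMultilinearMap f) z p =
      Values.map N (m + 2) (insertFirst j i a f z p) := by
  induction z with
  | zero => simp
  | add x y hx hy => rw [map_add, map_add, add_apply, add_apply, map_add, hx, hy]
  | tmul P c =>
    rw [insertFirst_tmul, insertFirst_tmul, Values.map_smul, Values.map_subst]
    rfl

theorem SesquilinearBracket.bracketSum_compMultilinearMap_map (B : SesquilinearBracket L)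
    (N : L →ₗ[ℂ[X]] L) {n : ℕ} (f : MultilinearMap ℂ (fun _ : Fin n => L) (Values L n)) :
    B.bracketSum ((Values.map N n).compMultilinearMap f) =
      (Values.map N (n + 1)).compMultilinearMap (B.bracketSum f) := by
  ext p
  cases n with
  | zero => simp [bracketSum]
  | succ m =>
    simp only [bracketSum, LinearMap.compMultilinearMap_apply, sum_apply, map_sum,
      smul_apply, map_zsmul, bracketTerm_apply, insertFirst_compMultilinearMap_map]

theorem SesquilinearBracket.actSum_deform (B : SesquilinearBracket L) (N : L →ₗ[ℂ[X]] L) {n : ℕ}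
    (f : MultilinearMap ℂ (fun _ : Fin n => L) (Values L n)) :
    (B.deform N).actSum f = (B.compLeft N).actSum f +
      B.actSum ((Values.map N n).compMultilinearMap f) -
        (Values.map N (n + 1)).compMultilinearMap (B.actSum f) := by
  ext p
  simp only [sub_apply, add_apply, LinearMap.compMultilinearMap_apply, actSum_apply, map_sum,
    map_zsmul, actTerm_apply, act_deform, smul_add, smul_sub, Finset.sum_add_distrib,
    Finset.sum_sub_distrib]

/-- `∑_k f(…, N(p_k), …)`. -/
noncomputable def sumComp (N : L →ₗ[ℂ[X]] L) {n : ℕ}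
    (f : MultilinearMap ℂ (fun _ : Fin n => L) (Values L n)) :
    MultilinearMap ℂ (fun _ : Fin n => L) (Values L n) :=
  ∑ k, f.compLinearMap (Function.update (fun _ => LinearMap.id) k (N.restrictScalars ℂ))

theorem sumComp_apply (N : L →ₗ[ℂ[X]] L) {n : ℕ}
    (f : MultilinearMap ℂ (fun _ : Fin n => L) (Values L n)) (p : Fin n → L) :
    sumComp N f p = ∑ k, f (Function.update p k (N (p k))) := by
  rw [sumComp, sum_apply]
  refine Finset.sum_congr rfl fun k _ => ?_
  rw [MultilinearMap.compLinearMap_apply]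
  congr 1
  ext l
  rcases eq_or_ne l k with rfl | h <;> simp [*]

theorem sumComp_mem (N : L →ₗ[ℂ[X]] L) {n : ℕ}
    {f : MultilinearMap ℂ (fun _ : Fin n => L) (Values L n)} (hf : f ∈ Cochain L n) :
    sumComp N f ∈ Cochain L n := by
  refine ⟨fun p k => ?_, fun σ p => ?_⟩
  · rw [sumComp_apply, sumComp_apply, Finset.smul_sum, ← Finset.sum_neg_distrib]
    refine Finset.sum_congr rfl fun l _ => ?_
    rw [← hf.1]
    congr 1
    rcases eq_or_ne k l with rfl | h
    · simp [del_comm]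
    · rw [Function.update_of_ne h.symm, Function.update_of_ne h, Function.update_comm h]
  · rw [sumComp_apply, sumComp_apply, map_sum, Finset.smul_sum,
      ← Equiv.sum_comp σ fun k => (Equiv.Perm.sign σ : ℤ) • f (Function.update p k (N (p k)))]
    refine Finset.sum_congr rfl fun l _ => ?_
    rw [← hf.2]
    congr 2
    ext k
    rcases eq_or_ne k l with rfl | h <;> simp [*]

/-- In the term `[p_i, f(…)]`, the operator `N` falls either on `p_i` or on one of the arguments of
`f`. -/
theorem SesquilinearBracket.actSum_sumComp (B : SesquilinearBracket L) (N : L →ₗ[ℂ[X]] L) {n : ℕ}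
    (f : MultilinearMap ℂ (fun _ : Fin n => L) (Values L n)) :
    sumComp N (B.actSum f) = (B.compLeft N).actSum f + B.actSum (sumComp N f) := by
  ext p
  rw [sumComp_apply, add_apply]
  simp only [actSum_apply]
  rw [Finset.sum_comm, ← Finset.sum_add_distrib]
  refine Finset.sum_congr rfl fun i _ => ?_
  rw [← Finset.smul_sum, ← smul_add, Fin.sum_univ_succAbove _ i]
  simp only [actTerm_apply, sumComp_apply, map_sum]
  congr 2
  · simp [act_compLeft]
  · refine Finset.sum_congr rfl fun k _ => ?_
    rw [Function.update_of_ne (Fin.succAbove_ne i k).symm]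
    congr 2
    ext l
    simp [Function.update_apply]

theorem insertFirst_sumComp (N : L →ₗ[ℂ[X]] L) {m : ℕ} (j : Fin (m + 2)) (i : Fin (m + 1))
    (a : MvPolynomial (Fin (m + 2)) ℂ)
    (f : MultilinearMap ℂ (fun _ : Fin (m + 1) => L) (Values L (m + 1)))
    (z : ℂ[X] ⊗[ℂ] L) (p : Fin m → L) :
    insertFirst j i a (sumComp N f) z p =
      insertFirst j i a f ((N.restrictScalars ℂ).baseChange ℂ[X] z) p +
        ∑ k, insertFirst j i a f z (Function.update p k (N (p k))) := by
  induction z with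
  | zero => simp
  | add x y hx hy =>
    simp only [map_add, add_apply, hx, hy, Finset.sum_add_distrib]
    abel
  | tmul P c =>
    simp only [LinearMap.baseChange_tmul, insertFirst_tmul, sumComp_apply, Fin.sum_univ_succ,
      map_add, smul_add, map_sum, Finset.smul_sum, Fin.cons_zero, Fin.cons_succ,
      Fin.update_cons_zero, Fin.cons_update, LinearMap.restrictScalars_apply]

/-- When `N` falls on `p_{i'}` or `p_j`, the two terms add up to `[p_{i'}, p_j]_N + N([p_{i'},
p_j])` inside `f`. The second part is just the first-slot summand of `sumComp N f`, whose other
summands come from `N` falling on the remaining arguments. -/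
theorem SesquilinearBracket.bracketTerm_sumComp (B : SesquilinearBracket L) (N : L →ₗ[ℂ[X]] L)
    {m : ℕ} (j : Fin (m + 2)) (i : Fin (m + 1))
    (f : MultilinearMap ℂ (fun _ : Fin (m + 1) => L) (Values L (m + 1))) (p : Fin (m + 2) → L) :
    ∑ k, B.bracketTerm j i f (Function.update p k (N (p k))) =
      (B.deform N).bracketTerm j i f p + B.bracketTerm j i (sumComp N f) p := by
  rw [Fin.sum_univ_succAbove _ j, Fin.sum_univ_succAbove _ i]
  have h : ∀ k, (fun l => Function.update p (j.succAbove (i.succAbove k))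
      (N (p (j.succAbove (i.succAbove k)))) (j.succAbove (i.succAbove l))) =
      Function.update (fun l => p (j.succAbove (i.succAbove l))) k
        (N (p (j.succAbove (i.succAbove k)))) := fun k => by
    ext l; simp [Function.update_apply]
  simp only [bracketTerm_apply, insertFirst_sumComp, h]
  simp [deform]
  abel

theorem SesquilinearBracket.bracketSum_sumComp (B : SesquilinearBracket L) (N : L →ₗ[ℂ[X]] L)
    {n : ℕ} (f : MultilinearMap ℂ (fun _ : Fin n => L) (Values L n)) :
    sumComp N (B.bracketSum f) = (B.deform N).bracketSum f + B.bracketSum (sumComp N f) := by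
  ext p
  rw [sumComp_apply, add_apply]
  cases n with
  | zero => simp [bracketSum]
  | succ m =>
    simp only [bracketSum, sum_apply, smul_apply]
    rw [Finset.sum_comm, ← Finset.sum_add_distrib]
    refine Finset.sum_congr rfl fun j _ => ?_
    rw [Finset.sum_comm, ← Finset.sum_add_distrib]
    refine Finset.sum_congr rfl fun i _ => ?_
    rw [← Finset.smul_sum, ← smul_add, B.bracketTerm_sumComp]

/-- `sumComp` as a map of cochains. -/
noncomputable def sumCompMap (N : L →ₗ[ℂ[X]] L) {n : ℕ} (f : Cochain L n) : Cochain L n :=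
  ⟨sumComp N f.1, sumComp_mem N f.2⟩

variable (A : LieConformalAlgebra L) {N : L →ₗ[ℂ[X]] L} (hN : A.IsNijenhuis N)

/-- The part `d_N + N ∘ δ` of the differential of a Nijenhuis operator `N`. -/
noncomputable def LieConformalAlgebra.mixedCoboundary (n : ℕ) :
    Cochain L n →ₗ[ℂ] Cochain L (n + 1) :=
  (A.compLeft N).actMap n + (A.deformed N hN).bracketMap n

/-- As a commutator with `δ`, this operator anticommutes with `δ` as soon as `δ² = 0`. -/
theorem LieConformalAlgebra.mixedCoboundary_eq {n : ℕ} (f : Cochain L n) :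
    A.mixedCoboundary hN n f =
      sumCompMap N (A.coboundary n f) - A.coboundary n (sumCompMap N f) := by
  refine Subtype.ext ?_
  have h : sumComp N (A.actSum f.1 + A.bracketSum f.1) =
      sumComp N (A.actSum f.1) + sumComp N (A.bracketSum f.1) := by
    ext p; simp [sumComp_apply, Finset.sum_add_distrib]
  change (A.compLeft N).actSum f.1 + (A.deform N).bracketSum f.1 =
    sumComp N (A.actSum f.1 + A.bracketSum f.1) -
      (A.actSum (sumComp N f.1) + A.bracketSum (sumComp N f.1))
  rw [h, A.actSum_sumComp, A.bracketSum_sumComp]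
  abel

theorem LieConformalAlgebra.mixedCoboundary_anticomm {n : ℕ} (f : Cochain L n) :
    A.mixedCoboundary hN (n + 1) (A.coboundary n f) +
      A.coboundary (n + 1) (A.mixedCoboundary hN n f) = 0 := by
  have h : sumCompMap N (0 : Cochain L (n + 2)) = 0 := by
    refine Subtype.ext (MultilinearMap.ext fun p => ?_)
    exact (sumComp_apply N 0 p).trans (by simp)
  rw [A.mixedCoboundary_eq, A.mixedCoboundary_eq, map_sub, A.coboundary_coboundary,
    A.coboundary_coboundary, h]
  abel

/-- Both sides share the bracket part, built from `[·_λ ·]_N`. The rest is the expansion of `[p_i,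
f(…)]_N` into its three terms. -/
theorem LieConformalAlgebra.deformed_coboundary {n : ℕ} (f : Cochain L n) :
    (A.deformed N hN).coboundary n f = A.mixedCoboundary hN n f +
      A.actMap n (postcomp N n f) - postcomp N (n + 1) (A.actMap n f) := by
  refine Subtype.ext ?_
  change (A.deform N).actSum f.1 + (A.deform N).bracketSum f.1 =
    (A.compLeft N).actSum f.1 + (A.deform N).bracketSum f.1 +
      A.actSum ((Values.map N n).compMultilinearMap f.1) -
        (Values.map N (n + 1)).compMultilinearMap (A.actSum f.1)
  rw [A.actSum_deform]
  abel

theorem LieConformalAlgebra.bracketMap_postcomp {n : ℕ} (f : Cochain L n) :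
    A.bracketMap n (postcomp N n f) = postcomp N (n + 1) (A.bracketMap n f) :=
  Subtype.ext (A.bracketSum_compMultilinearMap_map N f.1)

/-- The central computation: `δ_N δ f = Dδf + δ(N ∘ δf) = -δ(Df - N ∘ δf)`, where `D` is
`mixedCoboundary`. -/
theorem LieConformalAlgebra.deformed_coboundary_coboundary {n : ℕ} (f : Cochain L n) :
    (A.deformed N hN).coboundary (n + 1) (A.coboundary n f) =
      -A.coboundary (n + 1) (A.nijenhuisDifferential N hN n f) := by
  have hd : A.nijenhuisDifferential N hN n f =
      A.mixedCoboundary hN n f - postcomp N (n + 1) (A.coboundary n f) := rfl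
  have h1 := A.mixedCoboundary_anticomm hN f
  -- The bracket part commutes with `N`, and on `δf` it is minus the action part because `δ²f = 0`.
  have h2 : A.coboundary (n + 1) (postcomp N (n + 1) (A.coboundary n f)) =
      A.actMap (n + 1) (postcomp N (n + 1) (A.coboundary n f)) -
        postcomp N (n + 2) (A.actMap (n + 1) (A.coboundary n f)) := by
    have h3 : A.actMap (n + 1) (A.coboundary n f) + A.bracketMap (n + 1) (A.coboundary n f) = 0 :=
      A.coboundary_coboundary f
    rw [coboundary, LinearMap.add_apply, A.bracketMap_postcomp, eq_neg_of_add_eq_zero_right h3,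
      map_neg, sub_eq_add_neg]
  rw [hd, map_sub, h2, A.deformed_coboundary, eq_neg_of_add_eq_zero_left h1]
  abel

theorem LieConformalAlgebra.deformed_coboundary_Phi {n : ℕ} (f : Cochain L n) :
    (A.deformed N hN).coboundary (n + 1) (A.Phi n f) =
      A.Phi (n + 1) (A.nijenhuisDifferential N hN n f) := by
  simp only [Phi, LinearMap.smul_apply, map_zsmul, A.deformed_coboundary_coboundary,
    pow_succ _ (n + 1), mul_neg, mul_one, neg_smul, smul_neg,
    LinearMap.neg_apply]

end NijenhuisComplex

/-! ### The induced map on cohomology -/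

section CohomologyMap
variable {V W : ℕ → Type*} [∀ n, AddCommGroup (V n)] [∀ n, Module ℂ (V n)]
  [∀ n, AddCommGroup (W n)] [∀ n, Module ℂ (W n)]

theorem Cohomology.exists_map (D : ∀ n, V n →ₗ[ℂ] V (n + 1)) (E : ∀ n, W n →ₗ[ℂ] W (n + 1))
    (φ : ∀ n, V n →ₗ[ℂ] W (n + 1)) (h : ∀ n v, E (n + 1) (φ n v) = φ (n + 1) (D n v)) (n : ℕ) :
    ∃ Ψ : Cohomology D n →ₗ[ℂ] Cohomology E (n + 1), ∀ (v : V n) (hv : D n v = 0),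
      ∃ hw : E (n + 1) (φ n v) = 0,
        Ψ (Cohomology.mk D n v hv) = Cohomology.mk E (n + 1) (φ n v) hw := by
  have hker : ∀ v, D n v = 0 → E (n + 1) (φ n v) = 0 := fun v hv => by rw [h, hv, map_zero]
  -- In degree `0` the only coboundary is zero. In higher degrees `φ (D v) = E (φ v)` is a
  -- coboundary.
  have hbdry : ∀ v ∈ coboundaries D n, φ n v ∈ coboundaries E (n + 1) := by
    cases n with
    | zero =>
      intro v hv
      rw [show v = 0 from hv, map_zero]
      exact zero_mem _
    | succ n =>
      rintro _ ⟨v, rfl⟩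
      exact ⟨φ n v, h n v⟩
  refine ⟨Submodule.mapQ _ _ ((φ n).restrict (p := LinearMap.ker (D n))
    (q := LinearMap.ker (E (n + 1))) hker) fun v hv => hbdry v hv, fun v hv => ⟨hker v hv, rfl⟩⟩

end CohomologyMap

end LieConformal

theorem proposition3 {L : Type*} [AddCommGroup L] [Module ℂ L] [Module ℂ[X] L]
    [IsScalarTower ℂ ℂ[X] L] (A : LieConformal.LieConformalAlgebra L) (N : L →ₗ[ℂ[X]] L)
    (hN : A.IsNijenhuis N) :
    (∀ n : ℕ, (A.deformed N hN).coboundary (n + 1) ∘ₗ A.Phi n =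
      A.Phi (n + 1) ∘ₗ A.nijenhuisDifferential N hN n) ∧
    ∀ n : ℕ, ∃ Ψ : LieConformal.Cohomology (A.nijenhuisDifferential N hN) n →ₗ[ℂ]
        LieConformal.Cohomology (A.deformed N hN).coboundary (n + 1),
      ∀ (f : LieConformal.Cochain L n) (hf : A.nijenhuisDifferential N hN n f = 0),
        ∃ hg : (A.deformed N hN).coboundary (n + 1) (A.Phi n f) = 0,
          Ψ (LieConformal.Cohomology.mk (A.nijenhuisDifferential N hN) n f hf) =
            LieConformal.Cohomology.mk (A.deformed N hN).coboundary (n + 1) (A.Phi n f) hg :=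
  ⟨fun _ => LinearMap.ext fun f => A.deformed_coboundary_Phi hN f,
    fun n => LieConformal.Cohomology.exists_map (A.nijenhuisDifferential N hN)
      (A.deformed N hN).coboundary A.Phi (fun _ f => A.deformed_coboundary_Phi hN f) n⟩
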